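/- Let $\Bbbk$ be an algebraically closed field and let $W,U_1,U_2$ be finite-dimensional $\Bbbk$-vector spaces. $\mathbb P_\Bbbk W=\operatorname{Proj}\operatorname{Sym}W^*$ denotes the projective space of lines in $W$, and "embedding" means a locally closed immersion of schemes. **The matrix.** Let $M$ be a matrix with entries in $W^*$, i.e. a linear map $W\to U_1\otimes U_2$ written in bases of $U_1$ (rows) and $U_2$ (columns), and suppose that $0$ is the only vector of $W$ at which all entries of $M$ vanish. Let $\{\operatorname{rk}M\le i\}\subset\mathbb P_\Bbbk W$ be the closed subscheme defined by the $(i+1)\times(i+1)$ minors of $M$ and let $\{\operatorname{rk}M=1\}=\{\operatorname{rk}M\le1\}\setminus\{\operatorname{rk}M\le0\}$, a locally closed subscheme. It maps to the Segre variety, $\{\operatorname{rk}M=1\}\to\mathbb P_\Bbbk U_1\times\mathbb P_\Bbbk U_2\subset\mathbb P_\Bbbk(U_1\otimes U_2)$; let $\pi_{1,M}:\{\operatorname{rk}M=1\}\to\mathbb P_\Bbbk U_1$ be the first component of this morphism. **Linear independence.** A finite subscheme $R\subset\mathbb P_\Bbbk W$ is independent if its length $\dim_\Bbbk H^0(\mathcal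 O_R)$ equals the dimension of its affine linear span, i.e. of the subspace of $W$ perpendicular to all linear forms vanishing on $R$ (similarly for $U_1$). A subscheme imposes independent linear conditions to its subschemes of length at most $r$ if each of its finite subschemes of length at most $r$ is independent. **Cactus scheme.** A $\Bbbk$-scheme $Q$ has enough $\Bbbk$-points if it is locally Noetherian and the closure of each of its points contains a $\Bbbk$-point. Let $X\subset\mathbb P_\Bbbk W$ be a locally closed subscheme. An $r'$-familiar in $X$ over such a $Q$ is a subscheme $\mathcal R\subset Q\times X$, finite over $Q$ (not necessarily flat), whose fibre over every $\Bbbk$-point of $Q$ has length exactly $r'$; it is independent if all these fibres are independent subschemes of $\mathbb P_\Bbbk W$. Its linear span $\langle\mathcal R\rangle\subset Q\times\mathbb P_\Bbbk W$ is the closed subscheme defined by all forms of degree $0$ and $1$ on $W$, with coefficients in $\mathcal O_Q$ (locally on $Q$), that vanish on $\mathcal R$, and its relative linear span is the scheme-theoretic image of $\langle\mathcal R\rangle$ in $\mathbb P_\Bbbk W$. The $r$-th cactus scheme $\kappa_r(X)\subset\mathbb P_\Bbbk W$ is the scheme-theoretic closure of the union (that is, the smallest closed subscheme containing all) of the relative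 linear spans of all independent $r'$-familiars in $X$, for all $r'\le r$, over all $\Bbbk$-schemes $Q$ with enough $\Bbbk$-points. **Theorem.** Let $r\ge0$ and let $X\subset\{\operatorname{rk}M=1\}$ be a locally closed subscheme such that - $\pi_{1,M}$ restricted to $X$ is an embedding $X\to\mathbb P_\Bbbk U_1$, and - $\pi_{1,M}(X)\subset\mathbb P_\Bbbk U_1$ imposes independent linear conditions to its subschemes of length at most $r$. Then $\kappa_r(X)\subset\{\operatorname{rk}M\le r\}$ as closed subschemes of $\mathbb P_\Bbbk W$. -/

import Mathlib

universe u

open AlgebraicGeometry CategoryTheory Limits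

noncomputable section

namespace CactusScheme

attribute [local instance] MvPolynomial.gradedAlgebra

section ProjectiveSpace

variable (k : Type u) [Field k] (ι : Type)

/-- The projective space `ℙ_k W = Proj (Sym W^*)` for `W = k^ι`. -/
abbrev PSpace : Scheme.{u} := Proj (MvPolynomial.homogeneousSubmodule ι k)

/-- The structure morphism of the projective space. -/
def PSpace.str : PSpace k ι ⟶ Spec (.of k) :=
  Proj.toSpecZero _ ≫
    Spec.map (CommRingCat.ofHom (algebraMap k (MvPolynomial.homogeneousSubmodule ι k 0)))

variable {k ι}

lemma X_mem (i : ι) : MvPolynomial.X i ∈ MvPolynomial.homogeneousSubmodule ι k 1 :=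
  MvPolynomial.isHomogeneous_X k i

/-- The standard affine chart `{x_j ≠ 0}`. -/
def chart (j : ι) : (PSpace k ι).Opens :=
  Proj.basicOpen (MvPolynomial.homogeneousSubmodule ι k) (MvPolynomial.X j)

/-- The function `x_i / x_j` on the chart `{x_j ≠ 0}`. -/
def coordQuot (j i : ι) : Γ(PSpace k ι, chart j) :=
  (Proj.awayToSection (MvPolynomial.homogeneousSubmodule ι k) (MvPolynomial.X j)).hom
    (HomogeneousLocalization.Away.mk _ (d := 1) (X_mem j) 1
      (MvPolynomial.X i) (X_mem i))

/-- The `k`-algebra structure on the global functions of a scheme over `k`. -/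
def scalars {T : Scheme.{u}} (t : T ⟶ Spec (.of k)) : k →+* Γ(T, ⊤) :=
  t.appTop.hom.comp (Scheme.ΓSpecIso (.of k)).inv.hom

/-- The `k`-dimension of the global functions of `T`; this is the length of `T` when `T` is finite
over `k`. -/
def length {T : Scheme.{u}} (t : T ⟶ Spec (.of k)) : ℕ :=
  letI : Module k Γ(T, ⊤) := (scalars t).toModule
  Module.finrank k Γ(T, ⊤)

/-- Dehomogenization: a form `f` of degree `d` is sent to the function `f / x_j ^ d` on the chart
`{x_j ≠ 0}`. -/
def dehom (j : ι) : MvPolynomial ι k →+* Γ(PSpace k ι, chart j) :=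
  MvPolynomial.eval₂Hom
    (((PSpace k ι).presheaf.map (homOfLE le_top).op).hom.comp (scalars (PSpace.str k ι)))
    (coordQuot j)

/-- The form `f` vanishes identically along the morphism `g : T ⟶ ℙ_k W`. -/
def Vanishes {T : Scheme.{u}} (g : T ⟶ PSpace k ι) (f : MvPolynomial ι k) : Prop :=
  ∀ j, (g.app (chart j)).hom (dehom j f) = 0

/-- The ideal sheaf of the closed subscheme of `ℙ_k W` defined by a set of forms: the largest
closed subscheme along which all the forms vanish. -/
def zeroIdeal (S : Set (MvPolynomial ι k)) : (PSpace k ι).IdealSheafData :=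
  sInf {J | ∀ f ∈ S, Vanishes J.subschemeι f}

lemma isAffineOpen_chart (j : ι) : IsAffineOpen (chart (k := k) j) :=
  Proj.isAffineOpen_basicOpen _ _ (X_mem j) one_pos

lemma iSup_chart : ⨆ j, chart (k := k) (ι := ι) j = ⊤ := by
  apply Proj.iSup_basicOpen_eq_top'
  · exact fun i ↦ ⟨1, X_mem i⟩
  · rw [eq_top_iff]
    rintro p -
    induction p using MvPolynomial.induction_on with
    | C a =>
      exact Subalgebra.algebraMap_mem _
        (⟨MvPolynomial.C a, MvPolynomial.isHomogeneous_C _ _⟩ : MvPolynomial.homogeneousSubmodule ι k 0)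
    | add p q hp hq => exact add_mem hp hq
    | mul_X p i hp => exact mul_mem hp (Algebra.subset_adjoin ⟨i, rfl⟩)

lemma Vanishes.comp {T T' : Scheme.{u}} {g : T ⟶ PSpace k ι} {f : MvPolynomial ι k}
    (h : Vanishes g f) (t : T' ⟶ T) : Vanishes (t ≫ g) f := by
  intro j
  rw [Scheme.Hom.comp_app]
  exact (congrArg (t.app (g ⁻¹ᵁ chart j)).hom (h j)).trans (map_zero _)

lemma vanishes_subscheme_iff (J : (PSpace k ι).IdealSheafData) (f : MvPolynomial ι k) :
    Vanishes J.subschemeι f ↔ ∀ j, dehom j f ∈ J.ideal ⟨chart j, isAffineOpen_chart j⟩ := by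
  refine forall_congr' fun j ↦ ?_
  rw [← Scheme.IdealSheafData.ker_subschemeι_app, RingHom.mem_ker]

lemma vanishes_iff_ker {T : Scheme.{u}} (g : T ⟶ PSpace k ι) [QuasiCompact g]
    (f : MvPolynomial ι k) :
    Vanishes g f ↔ ∀ j, dehom j f ∈ g.ker.ideal ⟨chart j, isAffineOpen_chart j⟩ := by
  refine forall_congr' fun j ↦ ?_
  rw [Scheme.Hom.ker_apply, RingHom.mem_ker]

/-- `(x_i / x_j') = (x_j / x_j') * (x_i / x_j)` on the overlap of two charts. -/
lemma coordQuot_res (j j' i : ι) :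
    ((PSpace k ι).presheaf.map (homOfLE (inf_le_right : chart j ⊓ chart j' ≤ _)).op).hom
      (coordQuot j' i) =
    ((PSpace k ι).presheaf.map (homOfLE (inf_le_right : chart j ⊓ chart j' ≤ _)).op).hom
      (coordQuot j' j) *
    ((PSpace k ι).presheaf.map (homOfLE (inf_le_left : chart j ⊓ chart j' ≤ _)).op).hom
      (coordQuot j i) := by
  apply Subtype.ext
  funext p
  apply HomogeneousLocalization.val_injective
  let q : ProjectiveSpectrum (MvPolynomial.homogeneousSubmodule ι k) := p.1
  have : q.asHomogeneousIdeal.toIdeal.IsPrime := q.isPrime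
  have hX (a : ι) : MvPolynomial.X a ∈ MvPolynomial.homogeneousSubmodule ι k (1 • 1) :=
    MvPolynomial.isHomogeneous_X k a
  have hX' (a : ι) : MvPolynomial.X a ^ 1 ∈ MvPolynomial.homogeneousSubmodule ι k (1 • 1) :=
    (MvPolynomial.isHomogeneous_X k a).pow 1
  let f (a b : ι) (hb : MvPolynomial.X b ∈ q.asHomogeneousIdeal.toIdeal.primeCompl) :
      HomogeneousLocalization.AtPrime (MvPolynomial.homogeneousSubmodule ι k)
        q.asHomogeneousIdeal.toIdeal :=
    HomogeneousLocalization.mk ⟨1 • 1, ⟨MvPolynomial.X a, hX a⟩,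
      ⟨MvPolynomial.X b ^ 1, hX' b⟩, pow_mem hb 1⟩
  change HomogeneousLocalization.val (f i j' p.2.2) =
    HomogeneousLocalization.val (f j j' p.2.2 * f i j p.2.1)
  rw [HomogeneousLocalization.val_mul]
  simp only [f, HomogeneousLocalization.val_mk]
  rw [Localization.mk_mul, Localization.mk_eq_mk_iff, Localization.r_iff_exists]
  refine ⟨1, ?_⟩
  simp only [pow_one, OneMemClass.coe_one, one_mul, Submonoid.coe_mul]
  ring

lemma eval₂_smul_of_isHomogeneous {R B : Type*} [CommRing R] [CommRing B] (φ : R →+* B)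
    (u : B) (v : ι → B) {f : MvPolynomial ι R} {d : ℕ} (hf : f.IsHomogeneous d) :
    MvPolynomial.eval₂ φ (fun i ↦ u * v i) f = u ^ d * MvPolynomial.eval₂ φ v f := by
  rw [MvPolynomial.eval₂_eq, MvPolynomial.eval₂_eq, Finset.mul_sum]
  refine Finset.sum_congr rfl fun m hm ↦ ?_
  have : ∑ i ∈ m.support, m i = d := by
    have := hf (MvPolynomial.mem_support_iff.mp hm)
    simpa [Finsupp.weight_apply, Finsupp.sum] using this
  simp only [mul_pow, Finset.prod_mul_distrib, Finset.prod_pow_eq_pow_sum, this]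
  ring

/-- The restriction of the dehomogenization to a smaller open set, written as a substitution. -/
lemma res_dehom (j : ι) {U : (PSpace k ι).Opens} (hU : U ≤ chart j) (f : MvPolynomial ι k) :
    ((PSpace k ι).presheaf.map (homOfLE hU).op).hom (dehom j f) =
      MvPolynomial.eval₂
        (((PSpace k ι).presheaf.map (homOfLE le_top).op).hom.comp (scalars (PSpace.str k ι)))
        (fun i ↦ ((PSpace k ι).presheaf.map (homOfLE hU).op).hom (coordQuot j i)) f := by
  rw [dehom, MvPolynomial.coe_eval₂Hom, MvPolynomial.hom_eval₂, ← RingHom.comp_assoc,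
    ← CommRingCat.hom_comp, ← Functor.map_comp, ← op_comp, homOfLE_comp]

lemma dehom_res (j j' : ι) {f : MvPolynomial ι k} {d : ℕ} (hf : f.IsHomogeneous d) :
    ((PSpace k ι).presheaf.map (homOfLE (inf_le_right : chart j ⊓ chart j' ≤ _)).op).hom
      (dehom j' f) =
    ((PSpace k ι).presheaf.map (homOfLE (inf_le_right : chart j ⊓ chart j' ≤ _)).op).hom
      (coordQuot j' j) ^ d *
    ((PSpace k ι).presheaf.map (homOfLE (inf_le_left : chart j ⊓ chart j' ≤ _)).op).hom
      (dehom j f) := by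
  rw [res_dehom, res_dehom, ← eval₂_smul_of_isHomogeneous _ _ _ hf]
  exact congrArg (fun v ↦ MvPolynomial.eval₂ _ v f) (funext (coordQuot_res j j'))

lemma res_injective {T : Scheme.{u}} {U V : T.Opens} (h : U ⟶ V) (e : U = V) :
    Function.Injective (T.presheaf.map h.op).hom := by
  subst e
  obtain rfl : h = 𝟙 U := rfl
  rw [op_id, CategoryTheory.Functor.map_id]
  exact Function.injective_id

/-- A form that vanishes along a morphism on one chart vanishes there, when the morphism factors
through this chart. -/
lemma vanishes_of_chart {T : Scheme.{u}} (g : T ⟶ PSpace k ι) (j : ι)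
    (hg : g ⁻¹ᵁ chart j = ⊤) {f : MvPolynomial ι k} {d : ℕ} (hf : f.IsHomogeneous d)
    (h : (g.app (chart j)).hom (dehom j f) = 0) : Vanishes g f := by
  intro j'
  have e : g ⁻¹ᵁ (chart j ⊓ chart j') = g ⁻¹ᵁ chart j' := by
    rw [Scheme.Hom.preimage_inf, hg, top_inf_eq]
  have key (x : Γ(PSpace k ι, chart j')) (hx : (g.app (chart j ⊓ chart j')).hom
      (((PSpace k ι).presheaf.map (homOfLE (inf_le_right : chart j ⊓ chart j' ≤ _)).op).hom x) = 0) :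
      (g.app (chart j')).hom x = 0 := by
    rw [← RingHom.comp_apply, ← CommRingCat.hom_comp, g.naturality] at hx
    exact res_injective _ e (by simpa using hx)
  apply key
  rw [dehom_res j j' hf, map_mul, ← RingHom.comp_apply _ _ (dehom j f), ← CommRingCat.hom_comp,
    g.naturality, CommRingCat.hom_comp, RingHom.comp_apply, h, map_zero, mul_zero]

/-- The part in one chart of the zero scheme of a set of forms. -/
def chartZero (S : Set (MvPolynomial ι k)) (j : ι) :
    Spec (.of (Γ(PSpace k ι, chart j) ⧸ Ideal.span (dehom j '' S))) ⟶ PSpace k ι :=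
  Spec.map (CommRingCat.ofHom (Ideal.Quotient.mk (Ideal.span (dehom j '' S)))) ≫
    (isAffineOpen_chart j).fromSpec

lemma chartZero_preimage (S : Set (MvPolynomial ι k)) (j : ι) :
    chartZero S j ⁻¹ᵁ chart j = ⊤ := by
  rw [chartZero, Scheme.Hom.comp_preimage, IsAffineOpen.fromSpec_preimage_self]
  rfl

lemma chartZero_app (S : Set (MvPolynomial ι k)) (j : ι) (x : Γ(PSpace k ι, chart j)) :
    ((chartZero S j).app (chart j)).hom x = 0 ↔ x ∈ Ideal.span (dehom j '' S) := by
  let φ := CommRingCat.ofHom (Ideal.Quotient.mk (Ideal.span (dehom j '' S)))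
  have h1 : (chartZero S j).app (chart j) = φ ≫ (Scheme.ΓSpecIso _).inv ≫
      (Spec _).presheaf.map (homOfLE le_top).op := by
    rw [chartZero, Scheme.Hom.comp_app, IsAffineOpen.fromSpec_app_self, Category.assoc,
      Scheme.Hom.naturality, ← Category.assoc, ← Category.assoc, Scheme.ΓSpecIso_inv_naturality]
    rfl
  rw [h1]
  have h2 : Function.Injective ((Scheme.ΓSpecIso (.of (Γ(PSpace k ι, chart j) ⧸
      Ideal.span (dehom j '' S)))).inv ≫ (Spec _).presheaf.map
      (homOfLE (le_top : chartZero S j ⁻¹ᵁ chart j ≤ ⊤)).op).hom := by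
    rw [CommRingCat.hom_comp, RingHom.coe_comp]
    exact (res_injective _ (chartZero_preimage S j)).comp
      (ConcreteCategory.bijective_of_isIso _).1
  rw [CommRingCat.hom_comp, RingHom.comp_apply, map_eq_zero_iff _ h2]
  exact Ideal.Quotient.eq_zero_iff_mem

/-- The forms in `S` vanish along the zero scheme of `S`. -/
lemma vanishes_zeroIdeal [Finite ι] {S : Set (MvPolynomial ι k)}
    (hS : ∀ f ∈ S, ∃ d, f.IsHomogeneous d) {f : MvPolynomial ι k} (hf : f ∈ S) :
    Vanishes (zeroIdeal S).subschemeι f := by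
  have h0 (i : ι) : Vanishes (chartZero S i) f := by
    obtain ⟨d, hd⟩ := hS f hf
    exact vanishes_of_chart _ i (chartZero_preimage S i) hd
      ((chartZero_app S i _).mpr (Ideal.subset_span ⟨f, hf, rfl⟩))
  have h1 : ⨅ i, (chartZero S i).ker ≤ zeroIdeal S := by
    refine le_sInf fun J hJ ↦ ?_
    refine Scheme.IdealSheafData.le_of_iSup_eq_top
      (fun j ↦ ⟨chart j, isAffineOpen_chart j⟩) iSup_chart fun j ↦ ?_
    rw [Scheme.IdealSheafData.ideal_iInf, iInf_apply]
    refine (iInf_le _ j).trans fun x hx ↦ ?_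
    rw [Scheme.Hom.ker_apply, RingHom.mem_ker, chartZero_app] at hx
    refine Ideal.span_le.mpr ?_ hx
    rintro _ ⟨f', hf', rfl⟩
    exact (vanishes_subscheme_iff J f').mp (hJ f' hf') j
  rw [vanishes_subscheme_iff]
  intro j
  refine h1 _ ?_
  rw [Scheme.IdealSheafData.ideal_iInf, iInf_apply]
  simp only [Ideal.mem_iInf]
  exact fun i ↦ (vanishes_iff_ker _ f).mp (h0 i) j

/-- A point of the projective space outside of the zero scheme of `S` lies in some `{f / x_j ≠ 0}`
for `f ∈ S`. -/
lemma exists_mem_basicOpen {S : Set (MvPolynomial ι k)} {y : PSpace k ι}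
    (hy : y ∉ (zeroIdeal S).support) :
    ∃ f ∈ S, ∃ j, y ∈ (PSpace k ι).basicOpen (dehom j f) := by
  by_contra! H
  apply hy
  let z := (PSpace k ι).fromSpecResidueField y
  have hz : ∀ f ∈ S, Vanishes z f := by
    intro f hf j
    rw [← basicOpen_eq_bot_iff, ← Scheme.preimage_basicOpen]
    ext x
    have : z x ∉ (PSpace k ι).basicOpen (dehom j f) := by
      rw [Scheme.fromSpecResidueField_apply]
      exact H f hf j
    exact iff_of_false this id
  have h1 : zeroIdeal S ≤ z.ker := by
    refine sInf_le fun f hf ↦ ?_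
    rw [vanishes_subscheme_iff, ← vanishes_iff_ker]
    exact hz f hf
  refine Scheme.IdealSheafData.support_antitone h1 (z.range_subset_ker_support ?_)
  simp [z]

/-! ### Morphisms to projective space given by functions -/

/-- The evaluation `a / t ^ n ↦ f a / f t ^ n` of homogeneous fractions of degree zero. -/
def awayLift {B : Type u} [CommRing B] (f : MvPolynomial ι k →+* B) (t : MvPolynomial ι k)
    (ht : IsUnit (f t)) :
    HomogeneousLocalization.Away (MvPolynomial.homogeneousSubmodule ι k) t →+* B :=
  (IsLocalization.Away.lift (S := Localization.Away t) t ht).comp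
    (algebraMap (HomogeneousLocalization.Away (MvPolynomial.homogeneousSubmodule ι k) t)
      (Localization.Away t))

lemma awayLift_mk {B : Type u} [CommRing B] (f : MvPolynomial ι k →+* B) (t : MvPolynomial ι k)
    (ht : IsUnit (f t)) {d : ℕ} (hd : t ∈ MvPolynomial.homogeneousSubmodule ι k d) (n : ℕ)
    (a : MvPolynomial ι k) (ha : a ∈ MvPolynomial.homogeneousSubmodule ι k (n • d)) :
    awayLift f t ht (HomogeneousLocalization.Away.mk _ hd n a ha) * f t ^ n = f a := by
  rw [awayLift, RingHom.comp_apply, HomogeneousLocalization.algebraMap_apply,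
    HomogeneousLocalization.Away.val_mk, Localization.mk_eq_mk']
  have h := IsLocalization.Away.lift_eq (S := Localization.Away t) t ht
  rw [← map_pow, ← h (t ^ n), ← map_mul, ← h a]
  congr 1
  exact IsLocalization.mk'_spec (M := Submonoid.powers t) (Localization.Away t) a
    ⟨t ^ n, n, rfl⟩

lemma awayLift_comp {B B' : Type u} [CommRing B] [CommRing B'] (f : MvPolynomial ι k →+* B)
    (ρ : B →+* B') (t : MvPolynomial ι k) {d : ℕ}
    (hd : t ∈ MvPolynomial.homogeneousSubmodule ι k d) (ht : IsUnit (f t)) :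
    ρ.comp (awayLift f t ht) = awayLift (ρ.comp f) t (ht.map ρ) := by
  ext x
  obtain ⟨n, a, ha, rfl⟩ := HomogeneousLocalization.Away.mk_surjective _ hd x
  apply ((ht.map ρ).pow n).mul_right_cancel
  have h := awayLift_mk (ρ.comp f) t (ht.map ρ) hd n a ha
  rw [RingHom.comp_apply] at h ⊢
  rw [h, ← map_pow, ← map_mul, awayLift_mk, RingHom.comp_apply]

lemma awayLift_awayMap {B : Type u} [CommRing B] (f : MvPolynomial ι k →+* B)
    {t g x : MvPolynomial ι k} {d e : ℕ}
    (hd : t ∈ MvPolynomial.homogeneousSubmodule ι k d)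
    (he : g ∈ MvPolynomial.homogeneousSubmodule ι k e) (hx : x = t * g)
    (ht : IsUnit (f t)) (hx' : IsUnit (f x)) :
    (awayLift f x hx').comp (HomogeneousLocalization.awayMap _ he hx) = awayLift f t ht := by
  ext y
  obtain ⟨n, a, ha, rfl⟩ := HomogeneousLocalization.Away.mk_surjective _ hd y
  apply (ht.pow n).mul_right_cancel
  apply ((isUnit_of_mul_isUnit_right (map_mul f t g ▸ hx ▸ hx')).pow n).mul_right_cancel
  have hdx : x ∈ MvPolynomial.homogeneousSubmodule ι k (d + e) :=
    hx ▸ SetLike.mul_mem_graded hd he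
  have hag : a * g ^ n ∈ MvPolynomial.homogeneousSubmodule ι k (n • (d + e)) := by
    rw [smul_add]
    exact SetLike.mul_mem_graded ha (SetLike.pow_mem_graded n he)
  have h1 : HomogeneousLocalization.awayMap (MvPolynomial.homogeneousSubmodule ι k) he hx
      (HomogeneousLocalization.Away.mk _ hd n a ha) =
      HomogeneousLocalization.Away.mk _ hdx n (a * g ^ n) hag := by
    apply HomogeneousLocalization.val_injective
    exact HomogeneousLocalization.val_awayMap_mk _ he hx _ _ _ _
  rw [RingHom.comp_apply, h1, awayLift_mk, mul_assoc, ← mul_pow, ← map_mul, ← hx, awayLift_mk,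
    map_mul, map_pow]

lemma awayLift_congr {B : Type u} [CommRing B] (f f' : MvPolynomial ι k →+* B)
    {t : MvPolynomial ι k} {d : ℕ}
    (hd : t ∈ MvPolynomial.homogeneousSubmodule ι k d)
    (ht : IsUnit (f t)) (ht' : IsUnit (f' t)) (v : B)
    (hv : ∀ (n : ℕ) (a : MvPolynomial ι k), a.IsHomogeneous n → f a = v ^ n * f' a) :
    awayLift f t ht = awayLift f' t ht' := by
  ext y
  obtain ⟨n, a, ha, rfl⟩ := HomogeneousLocalization.Away.mk_surjective _ hd y
  apply (ht.pow n).mul_right_cancel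
  rw [awayLift_mk, hv _ a ha, hv _ t hd, mul_pow, mul_left_comm, awayLift_mk, ← pow_mul,
    smul_eq_mul, mul_comm d n]

/-- The morphism `[f(y_0) : ... : f(y_n)]` to projective space, when `f(y_c)` is invertible. -/
def toPSpace {T : Scheme.{u}} (f : MvPolynomial ι k →+* Γ(T, ⊤)) (c : ι)
    (hc : IsUnit (f (MvPolynomial.X c))) : T ⟶ PSpace k ι :=
  T.toSpecΓ ≫ Spec.map (CommRingCat.ofHom (awayLift f (MvPolynomial.X c) hc)) ≫
    Proj.awayι _ _ (X_mem c) one_pos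

lemma comp_toPSpace {T T' : Scheme.{u}} (t : T' ⟶ T) (f : MvPolynomial ι k →+* Γ(T, ⊤)) (c : ι)
    (hc : IsUnit (f (MvPolynomial.X c))) :
    t ≫ toPSpace f c hc = toPSpace (t.appTop.hom.comp f) c (hc.map t.appTop.hom) := by
  rw [toPSpace, toPSpace, ← Category.assoc, Scheme.toSpecΓ_naturality, Category.assoc,
    ← Category.assoc (Spec.map _) (Spec.map _), ← Spec.map_comp]
  congr 3
  ext1
  exact awayLift_comp f t.appTop.hom _ (X_mem c) hc

lemma toPSpace_congr {T : Scheme.{u}} (f f' : MvPolynomial ι k →+* Γ(T, ⊤)) (c c' : ι)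
    (hc : IsUnit (f (MvPolynomial.X c))) (hc' : IsUnit (f' (MvPolynomial.X c'))) (v : Γ(T, ⊤))
    (hv' : IsUnit v)
    (hv : ∀ (n : ℕ) (a : MvPolynomial ι k), a.IsHomogeneous n → f a = v ^ n * f' a) :
    toPSpace f c hc = toPSpace f' c' hc' := by
  have hX (i : ι) : MvPolynomial.X i ∈ MvPolynomial.homogeneousSubmodule ι k 1 := X_mem i
  have h1 : IsUnit (f' (MvPolynomial.X c)) := by
    rw [hv 1 _ (hX c)] at hc
    exact isUnit_of_mul_isUnit_right hc
  have h2 : IsUnit (f (MvPolynomial.X c')) := by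
    rw [hv 1 _ (hX c')]
    exact (hv'.pow 1).mul hc'
  have h3 : IsUnit (f (MvPolynomial.X c * MvPolynomial.X c')) := by
    rw [map_mul]; exact hc.mul h2
  have h4 : IsUnit (f' (MvPolynomial.X c * MvPolynomial.X c')) := by
    rw [map_mul]; exact h1.mul hc'
  rw [toPSpace, toPSpace,
    ← awayLift_awayMap f (hX c) (hX c') rfl hc h3,
    ← awayLift_awayMap f' (hX c') (hX c) (mul_comm (MvPolynomial.X c) _) hc' h4,
    CommRingCat.ofHom_comp, CommRingCat.ofHom_comp, Spec.map_comp, Spec.map_comp, Category.assoc,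
    Category.assoc, Proj.SpecMap_awayMap_awayι, Proj.SpecMap_awayMap_awayι,
    awayLift_congr f f' (SetLike.mul_mem_graded (hX c) (hX c')) h3 h4 v hv]

/-! ### Rank loci of a matrix of linear forms -/

variable {κ₁ κ₂ : Type} (M : Matrix κ₁ κ₂ (MvPolynomial ι k))

/-- The `t × t` minors of `M` (repeated or permuted rows and columns only contribute zero or a
minor up to sign). -/
def minors (t : ℕ) : Set (MvPolynomial ι k) :=
  {f | ∃ (e₁ : Fin t → κ₁) (e₂ : Fin t → κ₂), f = (M.submatrix e₁ e₂).det}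

/-- The ideal sheaf of the closed subscheme `{rk M ≤ r}`, defined by the `(r+1) × (r+1)` minors. -/
def rankLE (r : ℕ) : (PSpace k ι).IdealSheafData :=
  zeroIdeal (minors M (r + 1))

/-- The locally closed subscheme `{rk M = r} = {rk M ≤ r} \ {rk M ≤ r - 1}`: the open subscheme of
`{rk M ≤ r}` which is the complement of the zero scheme of the `r × r` minors. -/
abbrev rankEq (r : ℕ) : Scheme.{u} :=
  ((rankLE M r).subschemeι ⁻¹ᵁ (zeroIdeal (minors M r)).support.compl).toScheme

/-- The inclusion of `{rk M = r}` into the projective space. -/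
def rankEqι (r : ℕ) : rankEq M r ⟶ PSpace k ι :=
  Scheme.Opens.ι _ ≫ (rankLE M r).subschemeι

instance (r : ℕ) : IsImmersion (rankEqι M r) := by
  unfold rankEqι
  infer_instance

variable {M}

lemma isHomogeneous_of_mem_minors (hM : ∀ a b, (M a b).IsHomogeneous 1) {t : ℕ}
    {f : MvPolynomial ι k} (hf : f ∈ minors M t) : f.IsHomogeneous t := by
  obtain ⟨e₁, e₂, rfl⟩ := hf
  rw [Matrix.det_apply]
  refine MvPolynomial.IsHomogeneous.sum _ _ _ fun σ _ ↦ ?_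
  rw [Units.smul_def, zsmul_eq_mul]
  have h1 := MvPolynomial.IsHomogeneous.prod Finset.univ
    (fun i ↦ M.submatrix e₁ e₂ (σ i) i) (fun _ ↦ 1) (fun i _ ↦ hM _ _)
  have h2 : ((Equiv.Perm.sign σ : ℤ) : MvPolynomial ι k).IsHomogeneous 0 := by
    rw [← map_intCast (MvPolynomial.C : k →+* MvPolynomial ι k)]
    exact MvPolynomial.isHomogeneous_C _ _
  simpa using h2.mul h1

/-- For a morphism `u` into `{x_j ≠ 0}` this is the substitution `y_a ↦ M_ab / x_j`. -/
def columnHom {T : Scheme.{u}} (u : T ⟶ PSpace k ι) (M : Matrix κ₁ κ₂ (MvPolynomial ι k)) (j : ι)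
    (b : κ₂) (hu : ⊤ ≤ u ⁻¹ᵁ chart j) : MvPolynomial κ₁ k →+* Γ(T, ⊤) :=
  MvPolynomial.eval₂Hom (scalars (u ≫ PSpace.str k ι))
    fun a ↦ (u.appLE (chart j) ⊤ hu).hom (dehom j (M a b))

lemma columnHom_isUnit {T : Scheme.{u}} (u : T ⟶ PSpace k ι) (j : ι) (c : κ₁)
    (b : κ₂) (hu : ⊤ ≤ u ⁻¹ᵁ (PSpace k ι).basicOpen (dehom j (M c b))) :
    IsUnit (columnHom u M j b (hu.trans (u.preimage_mono (Scheme.basicOpen_le _ _)))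
      (MvPolynomial.X c)) := by
  rw [columnHom, MvPolynomial.eval₂Hom_X',
    ← Scheme.Hom.map_appLE u hu (homOfLE (Scheme.basicOpen_le _ (dehom j (M c b)))).op,
    CommRingCat.hom_comp, RingHom.comp_apply]
  exact (RingedSpace.isUnit_res_basicOpen _ _).map _

/-- The morphism `[M_1b : ... : M_nb]`, the `b`-th column of `M`, for a morphism `u` into the locus
`{x_j ≠ 0, M_cb ≠ 0}`. -/
def column {T : Scheme.{u}} (u : T ⟶ PSpace k ι) (M : Matrix κ₁ κ₂ (MvPolynomial ι k)) (j : ι)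
    (c : κ₁) (b : κ₂) (hu : ⊤ ≤ u ⁻¹ᵁ (PSpace k ι).basicOpen (dehom j (M c b))) :
    T ⟶ PSpace k κ₁ :=
  toPSpace _ c (columnHom_isUnit u j c b hu)

lemma comp_column {T T' : Scheme.{u}} (t : T' ⟶ T) (u : T ⟶ PSpace k ι) (j : ι)
    (c : κ₁) (b : κ₂) (hu : ⊤ ≤ u ⁻¹ᵁ (PSpace k ι).basicOpen (dehom j (M c b)))
    (hu' : ⊤ ≤ (t ≫ u) ⁻¹ᵁ (PSpace k ι).basicOpen (dehom j (M c b))) :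
    t ≫ column u M j c b hu = column (t ≫ u) M j c b hu' := by
  rw [column, comp_toPSpace, column]
  refine toPSpace_congr _ _ _ _ _ _ 1 isUnit_one fun n f hf ↦ ?_
  rw [one_pow, one_mul]
  congr 1
  refine MvPolynomial.ringHom_ext (fun x ↦ ?_) fun a ↦ ?_
  · simp only [columnHom, RingHom.comp_apply, MvPolynomial.eval₂Hom_C]
    rfl
  · have h1 : t.appTop = t.appLE ⊤ ⊤ le_rfl := Scheme.Hom.app_eq_appLE t
    simp only [columnHom, RingHom.comp_apply, MvPolynomial.eval₂Hom_X']
    rw [← RingHom.comp_apply, ← CommRingCat.hom_comp, h1]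
    exact congrArg (fun φ ↦ φ.hom (dehom j (M a b)))
      (Scheme.Hom.appLE_comp_appLE t u (chart j) ⊤ ⊤ _ _)

lemma column_congr {T : Scheme.{u}} (u u' : T ⟶ PSpace k ι) (e : u = u')
    (hu2 : ∀ f ∈ minors M 2, Vanishes u f) (j j' : ι) (c c' : κ₁) (b b' : κ₂)
    (hu : ⊤ ≤ u ⁻¹ᵁ (PSpace k ι).basicOpen (dehom j (M c b)))
    (hu' : ⊤ ≤ u' ⁻¹ᵁ (PSpace k ι).basicOpen (dehom j' (M c' b')))
    (hM : ∀ a b, (M a b).IsHomogeneous 1) :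
    column u M j c b hu = column u' M j' c' b' hu' := by
  subst e
  have hj : ⊤ ≤ u ⁻¹ᵁ chart j := hu.trans (u.preimage_mono (Scheme.basicOpen_le _ _))
  have hj' : ⊤ ≤ u ⁻¹ᵁ chart j' := hu'.trans (u.preimage_mono (Scheme.basicOpen_le _ _))
  have hjj : ⊤ ≤ u ⁻¹ᵁ (chart j ⊓ chart j') := le_inf hj hj'
  have hc := columnHom_isUnit u j c b hu
  have hc' := columnHom_isUnit u j' c' b' hu'
  rw [columnHom, MvPolynomial.eval₂Hom_X'] at hc hc'
  let θ := (u.appLE (chart j ⊓ chart j') ⊤ hjj).hom (((PSpace k ι).presheaf.map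
    (homOfLE (inf_le_right : chart j ⊓ chart j' ≤ _)).op).hom (coordQuot j' j))
  have hθ (f : MvPolynomial ι k) (hf : f.IsHomogeneous 1) :
      (u.appLE (chart j') ⊤ hj').hom (dehom j' f) =
        θ * (u.appLE (chart j) ⊤ hj).hom (dehom j f) := by
    rw [← Scheme.Hom.map_appLE u hjj (homOfLE (inf_le_right : chart j ⊓ chart j' ≤ _)).op,
      ← Scheme.Hom.map_appLE u hjj (homOfLE (inf_le_left : chart j ⊓ chart j' ≤ _)).op,
      CommRingCat.hom_comp, CommRingCat.hom_comp, RingHom.comp_apply, RingHom.comp_apply,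
      dehom_res j j' hf, pow_one, map_mul]
  have hmin (a : κ₁) : (u.appLE (chart j) ⊤ hj).hom (dehom j (M a b)) *
      (u.appLE (chart j) ⊤ hj).hom (dehom j (M c' b')) =
      (u.appLE (chart j) ⊤ hj).hom (dehom j (M a b')) *
      (u.appLE (chart j) ⊤ hj).hom (dehom j (M c' b)) := by
    have h1 := hu2 _ ⟨![a, c'], ![b, b'], rfl⟩ j
    rw [Matrix.det_fin_two] at h1
    have h3 : (u.appLE (chart j) ⊤ hj).hom (dehom j (M a b * M c' b' - M a b' * M c' b)) = 0 := by
      rw [Scheme.Hom.appLE, CommRingCat.hom_comp, RingHom.comp_apply]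
      exact (congrArg _ h1).trans (map_zero _)
    simpa only [map_sub, map_mul, sub_eq_zero] using h3
  obtain ⟨w, hw⟩ := hc'
  let v : Γ(T, ⊤) := (u.appLE (chart j) ⊤ hj).hom (dehom j (M c' b)) * ↑w⁻¹
  have hv (a : κ₁) : (u.appLE (chart j) ⊤ hj).hom (dehom j (M a b)) =
      v * (u.appLE (chart j') ⊤ hj').hom (dehom j' (M a b')) := by
    have h2 : (u.appLE (chart j) ⊤ hj).hom (dehom j (M a b)) * w =
        (u.appLE (chart j) ⊤ hj).hom (dehom j (M c' b)) *
          (u.appLE (chart j') ⊤ hj').hom (dehom j' (M a b')) := by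
      rw [hw, hθ _ (hM _ _), hθ _ (hM _ _)]
      linear_combination θ * hmin a
    rw [← Units.eq_mul_inv_iff_mul_eq] at h2
    rw [h2]
    ring
  have hv' : IsUnit v := by
    rw [hv c] at hc
    exact isUnit_of_mul_isUnit_left hc
  refine toPSpace_congr _ _ _ _ _ _ v hv' fun n f hf ↦ ?_
  rw [columnHom, columnHom, MvPolynomial.coe_eval₂Hom, MvPolynomial.coe_eval₂Hom,
    ← eval₂_smul_of_isHomogeneous _ _ _ hf]
  exact congrArg (fun g ↦ MvPolynomial.eval₂ _ g f) (funext hv)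

lemma vanishes_rankEqι [Finite ι] (hM : ∀ a b, (M a b).IsHomogeneous 1) (r : ℕ)
    (f : MvPolynomial ι k) (hf : f ∈ minors M (r + 1)) : Vanishes (rankEqι M r) f :=
  (vanishes_zeroIdeal (fun _ hf ↦ ⟨_, isHomogeneous_of_mem_minors hM hf⟩) hf).comp _

lemma top_le_comp_preimage {T T' : Scheme.{u}} (t : T' ⟶ T) (u : T ⟶ PSpace k ι)
    {V : (PSpace k ι).Opens} (hu : ⊤ ≤ u ⁻¹ᵁ V) : ⊤ ≤ (t ≫ u) ⁻¹ᵁ V :=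
  fun _ _ ↦ hu trivial

/-- The open subscheme `{x_j ≠ 0, M_cb ≠ 0}` of `{rk M = 1}`. -/
def colOpen (M : Matrix κ₁ κ₂ (MvPolynomial ι k)) (s : ι × κ₁ × κ₂) : (rankEq M 1).Opens :=
  rankEqι M 1 ⁻¹ᵁ (PSpace k ι).basicOpen (dehom s.1 (M s.2.1 s.2.2))

lemma colOpen_isOpenCover (M : Matrix κ₁ κ₂ (MvPolynomial ι k)) :
    TopologicalSpace.IsOpenCover (colOpen M) := by
  refine top_le_iff.mp fun y _ ↦ TopologicalSpace.Opens.mem_iSup.mpr ?_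
  obtain ⟨_, ⟨e₁, e₂, rfl⟩, j, hj⟩ := exists_mem_basicOpen (S := minors M 1) (y := rankEqι M 1 y) y.2
  rw [Matrix.det_fin_one] at hj
  exact ⟨(j, e₁ 0, e₂ 0), hj⟩

lemma colOpen_le (M : Matrix κ₁ κ₂ (MvPolynomial ι k)) (s : ι × κ₁ × κ₂) :
    ⊤ ≤ ((colOpen M s).ι ≫ rankEqι M 1) ⁻¹ᵁ
      (PSpace k ι).basicOpen (dehom s.1 (M s.2.1 s.2.2)) :=
  fun y _ ↦ y.2

/-- The projection `π_{1,M} : {rk M = 1} ⟶ ℙ_k U₁`: a point at which `M` has rank one, so that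
`M = u ⊗ v`, is sent to `[u]`. On the locus where some entry in the `b`-th column of `M` does not
vanish it is given by this column, which is there a multiple of `u`. -/
def proj₁ [Finite ι] (M : Matrix κ₁ κ₂ (MvPolynomial ι k)) (hM : ∀ a b, (M a b).IsHomogeneous 1) :
    rankEq M 1 ⟶ PSpace k κ₁ :=
  (Scheme.openCoverOfIsOpenCover (rankEq M 1) (colOpen M) (colOpen_isOpenCover M)).glueMorphisms
    (fun s ↦ column ((colOpen M s).ι ≫ rankEqι M 1) M s.1 s.2.1 s.2.2 (colOpen_le M s))
    (fun s s' ↦ by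
      refine (comp_column _ _ _ _ _ _ (top_le_comp_preimage _ _ (colOpen_le M s))).trans
        (Eq.trans ?_ (comp_column _ _ _ _ _ _ (top_le_comp_preimage _ _ (colOpen_le M s'))).symm)
      refine column_congr _ _ ?_ (fun f hf ↦ ?_) _ _ _ _ _ _ _ _ hM
      · exact (Category.assoc _ _ _).symm.trans
          ((congrArg (· ≫ rankEqι M 1) pullback.condition).trans (Category.assoc _ _ _))
      · exact ((vanishes_rankEqι hM 1 f hf).comp _).comp _)

/-! ### Linear spans and linear independence of finite subschemes -/

/-- The subspace `W' ⊆ W = k^ι` perpendicular to all the linear forms vanishing on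
`g : R ⟶ ℙ_k W`, i.e. the affine linear span of `R`. -/
def affineSpan {R : Scheme.{u}} (g : R ⟶ PSpace k ι) [Fintype ι] : Submodule k (ι → k) where
  carrier := {w | ∀ a : ι → k, Vanishes g (∑ i, MvPolynomial.C (a i) * MvPolynomial.X i) →
    ∑ i, a i * w i = 0}
  add_mem' {v w} hv hw a ha := by
    simp only [Pi.add_apply, mul_add, Finset.sum_add_distrib, hv a ha, hw a ha, add_zero]
  zero_mem' a _ := by simp
  smul_mem' c w hw a ha := by
    simp only [Pi.smul_apply, smul_eq_mul, mul_left_comm, ← Finset.mul_sum, hw a ha, mul_zero]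

/-- A subscheme of `ℙ_k W` is linearly independent if it is finite over `k` and its length is the
dimension of its affine linear span. -/
def IsIndependent [Fintype ι] {R : Scheme.{u}} (g : R ⟶ PSpace k ι) : Prop :=
  IsFinite (g ≫ PSpace.str k ι) ∧
    length (g ≫ PSpace.str k ι) = Module.finrank k (affineSpan g)

/-- The subscheme `e : X ⟶ ℙ_k W` imposes independent linear conditions to its subschemes of
length at most `r`: every finite subscheme `R` of `X` of length at most `r` is linearly
independent. -/
def ImposesIndependentConditions [Fintype ι] {X : Scheme.{u}} (e : X ⟶ PSpace k ι) (r : ℕ) : Prop :=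
  ∀ (R : Scheme.{u}) (z : R ⟶ X), IsImmersion z → IsFinite (z ≫ e ≫ PSpace.str k ι) →
    length (z ≫ e ≫ PSpace.str k ι) ≤ r → IsIndependent (z ≫ e)

/-! ### Families of finite subschemes -/

/-- A `k`-scheme has enough `k`-points if it is locally Noetherian and the closure of every point
contains a `k`-point. -/
def HasEnoughPoints {Q : Scheme.{u}} (q : Q ⟶ Spec (.of k)) : Prop :=
  IsLocallyNoetherian Q ∧
    ∀ w : Q, ∃ s : Spec (.of k) ⟶ Q, s ≫ q = 𝟙 _ ∧ Set.range s ⊆ closure {w}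

/-- A finite family `R ⊆ Q ×_k X` of subschemes of `X ⊆ ℙ_k W` parametrised by a `k`-scheme `Q`
with enough `k`-points. -/
structure FiniteFamily {X : Scheme.{u}} (i : X ⟶ PSpace k ι) where
  /-- The base scheme. -/
  Q : Scheme.{u}
  /-- The structure morphism of the base. -/
  str : Q ⟶ Spec (.of k)
  enough : HasEnoughPoints str
  /-- The total space. -/
  R : Scheme.{u}
  /-- The inclusion of the total space into `Q ×_k X`. -/
  incl : R ⟶ pullback str (i ≫ PSpace.str k ι)
  isImmersion : IsImmersion incl
  isFinite : IsFinite (incl ≫ pullback.fst _ _)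

namespace FiniteFamily

variable {X : Scheme.{u}} {i : X ⟶ PSpace k ι} (F : FiniteFamily i)

/-- The projection of the family to the base. -/
def toBase : F.R ⟶ F.Q := F.incl ≫ pullback.fst _ _

/-- The projection of the family to the projective space `ℙ_k W`. -/
def toAmbient : F.R ⟶ PSpace k ι := F.incl ≫ pullback.snd _ _ ≫ i

/-- The fibre over a `k`-point of the base, as a subscheme of `ℙ_k W`. -/
def fibre (s : Spec (.of k) ⟶ F.Q) : pullback F.toBase s ⟶ PSpace k ι :=
  pullback.fst _ _ ≫ F.toAmbient

/-- The fibres over all the `k`-points have length exactly `r`. -/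
def HasDegree (r : ℕ) : Prop :=
  ∀ s : Spec (.of k) ⟶ F.Q, s ≫ F.str = 𝟙 _ →
    length (pullback.snd F.toBase s) = r

/-- The fibres over all the `k`-points are linearly independent. -/
def Independent [Fintype ι] : Prop :=
  ∀ s : Spec (.of k) ⟶ F.Q, s ≫ F.str = 𝟙 _ → IsIndependent (F.fibre s)

end FiniteFamily

/-- For `a : T ⟶ Q` and `g : T ⟶ ℙ_k W`, and a form `f` with coefficients in the functions on an
open subset `U` of `Q`: the form `f` vanishes along the part over `U` of
`(a, g) : T ⟶ Q ×_k ℙ_k W`. On the chart `{x_j ≠ 0}` the form of degree `d` is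
divided by `x_j ^ d`. -/
def VanishesOver {Q T : Scheme.{u}} (a : T ⟶ Q) (g : T ⟶ PSpace k ι) (U : Q.Opens)
    (f : MvPolynomial ι Γ(Q, U)) : Prop :=
  ∀ j, MvPolynomial.eval₂ (a.appLE U (a ⁻¹ᵁ U ⊓ g ⁻¹ᵁ chart j) inf_le_left).hom
    (fun l ↦ (g.appLE (chart j) (a ⁻¹ᵁ U ⊓ g ⁻¹ᵁ chart j) inf_le_right).hom (coordQuot j l)) f = 0

namespace FiniteFamily

variable {X : Scheme.{u}} {i : X ⟶ PSpace k ι} (F : FiniteFamily i)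

/-- The ideal sheaf of the (projective) linear span `⟨R⟩ ⊆ ℙ_Q W = Q ×_k ℙ_k W` of a family `R`:
it is defined by all the forms of degree `0` and `1`, with coefficients in the functions on affine
open subsets of `Q`, which vanish on `R`. -/
def linearSpan : (pullback F.str (PSpace.str k ι)).IdealSheafData :=
  sInf {J | ∀ (U : F.Q.affineOpens) (d : ℕ) (f : MvPolynomial ι Γ(F.Q, U)),
    d ≤ 1 → f.IsHomogeneous d → VanishesOver F.toBase F.toAmbient U f →
      VanishesOver (J.subschemeι ≫ pullback.fst _ _) (J.subschemeι ≫ pullback.snd _ _) U f}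

/-- The ideal sheaf of the relative linear span `⟪R⟫ ⊆ ℙ_k W`: the scheme theoretic image of the
linear span under the projection `ℙ_Q W ⟶ ℙ_k W`. -/
def relativeLinearSpan : (PSpace k ι).IdealSheafData :=
  (F.linearSpan.subschemeι ≫ pullback.snd F.str (PSpace.str k ι)).ker

end FiniteFamily

/-- The ideal sheaf of the `r`-th cactus scheme of `X ⊆ ℙ_k W`: the smallest closed subscheme
containing the relative linear spans of all the independent families of finite subschemes of `X` of
constant length `r' ≤ r`. -/
def cactus [Fintype ι] (r : ℕ) {X : Scheme.{u}} (i : X ⟶ PSpace k ι) :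
    (PSpace k ι).IdealSheafData :=
  sInf {J | ∃ (r' : ℕ) (F : FiniteFamily i), r' ≤ r ∧ F.HasDegree r' ∧ F.Independent ∧
    J = F.relativeLinearSpan}

end ProjectiveSpace
end CactusScheme
end

noncomputable section

namespace CactusScheme

attribute [local instance] MvPolynomial.gradedAlgebra

/-! ### Commutative algebra: factorization of matrices, Nakayama, general linear combinations. -/

section Algebra

/-! Let `R` be an independent family of degree `n ≤ r` over `Q`. Near a `k`-point `s` of `Q`, let
`A` and `B` be the functions on an affine neighbourhood and on its preimage in `R`. Once a linear
form `ℓ` without zeros on `R` is chosen, division by `ℓ` sends linear forms over `A` to `B`; call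
this map `Φ`. Since `M` has rank one along `R`, its image under `Φ` is a product `u_a v_b`.
Independence of the fibre at `s` says that linear forms generate the functions on it, so `n` of them
form a basis there, and by Nakayama they generate `B` after multiplication by some `h` with `h(s) =
1`.

Multiplication in `B` now factors `M`: expand `u_a` in the `n` generators, then lift each product of
a generator with `v_b` back to a linear form. So, up to `h²` and modulo `ker Φ`, the matrix `M` is a
product of a matrix with `n` columns and one with `n` rows. The linear span of `R` is cut out by
forms that include `ker Φ`, so the factorization holds there and the minors of size `> n` are killed
by a power of `h`. Every point of `Q` specializes to some such `s`, and `h` is invertible near `s`,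
so these minors vanish on the whole span and on its image in projective space.

The factorization is `pow_mul_det_eq_zero`, the generators come from `exists_linear_generators`, and
`vanishes_minor` combines them. -/

lemma det_mul_eq_zero_of_lt {C : Type*} [CommRing C] {n t : ℕ} (h : n < t)
    (D : Matrix (Fin t) (Fin n) C) (E : Matrix (Fin n) (Fin t) C) : (D * E).det = 0 := by
  -- Padding by zeros makes both factors square without changing the product; column `n` of `D'` is
  -- then zero.
  let D' : Matrix (Fin t) (Fin t) C := fun i j ↦ if hj : j.1 < n then D i ⟨j, hj⟩ else 0
  let E' : Matrix (Fin t) (Fin t) C := fun i j ↦ if hi : i.1 < n then E ⟨i, hi⟩ j else 0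
  have : D * E = D' * E' := by
    ext i j
    rw [Matrix.mul_apply, Matrix.mul_apply]
    refine Finset.sum_of_injOn (Fin.castLE h.le) (Fin.castLE_injective h.le).injOn
      (fun _ _ ↦ Finset.mem_coe.mpr (Finset.mem_univ _)) (fun s _ hs ↦ ?_) fun s _ ↦ ?_
    · have hs' : ¬ s.1 < n := fun hs' ↦ hs ⟨⟨s, hs'⟩, by simp, rfl⟩
      simp [D', hs']
    · simp [D', E']
  rw [this, Matrix.det_mul, Matrix.det_eq_zero_of_column_eq_zero (⟨n, h⟩ : Fin t), zero_mul]
  intro i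
  simp [D']

/-- If `Φ : L → B` sends the entries of a matrix `N` to products `u_a v_b` and `B` is generated,
after multiplication by `h`, by `n` elements of the range of `Φ`, then the minors of size
bigger than `n` of the image of `N` under any linear map that vanishes on the kernel of `Φ` are
killed by a power of `h`. -/
lemma pow_mul_det_eq_zero {A B C L κ₁ κ₂ : Type*} [CommRing A] [CommRing B] [CommRing C]
    [Algebra A B] [Algebra A C] [AddCommGroup L] [Module A L]
    (Φ : L →ₗ[A] B) (Ψ : L →ₗ[A] C) (hΦΨ : ∀ x, Φ x = 0 → Ψ x = 0)
    (N : κ₁ → κ₂ → L) (u : κ₁ → B) (v : κ₂ → B) (huv : ∀ a b, Φ (N a b) = u a * v b)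
    {n t : ℕ} (ht : n < t) (e : Fin n → L) (h : A)
    (hh : ∀ x : B, h • x ∈ Submodule.span A (Set.range fun s ↦ Φ (e s)))
    (e₁ : Fin t → κ₁) (e₂ : Fin t → κ₂) :
    (algebraMap A C h ^ 2) ^ t * (Matrix.of fun i j ↦ Ψ (N (e₁ i) (e₂ j))).det = 0 := by
  have hd (a : κ₁) := (Submodule.mem_span_range_iff_exists_fun A).mp (hh (u a))
  choose d hd using hd
  have hE (s : Fin n) (b : κ₂) : ∃ z, Φ z = h • (Φ (e s) * v b) := by
    obtain ⟨c, hc⟩ := (Submodule.mem_span_range_iff_exists_fun A).mp (hh (Φ (e s) * v b))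
    exact ⟨∑ i, c i • e i, by rw [← hc]; simp⟩
  choose z hz using hE
  -- One factor `h` expands `u a` in the generators, the other lifts `Φ (e s) * v b` to `z s b`. The
  -- identity holds in `B`, hence in `L` modulo the kernel of `Φ`, hence in `C`.
  have key (a : κ₁) (b : κ₂) :
      algebraMap A C h ^ 2 * Ψ (N a b) = ∑ s, algebraMap A C (d a s) * Ψ (z s b) := by
    have h1 : Φ ((h * h) • N a b - ∑ s, d a s • z s b) = 0 := by
      have h2 : (h * h) • (u a * v b) = h • ((h • u a) * v b) := by
        rw [mul_smul, smul_mul_assoc]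
      rw [map_sub, map_smul, huv, h2, ← hd, map_sum, sub_eq_zero, Finset.sum_mul, Finset.smul_sum]
      refine Finset.sum_congr rfl fun s _ ↦ ?_
      rw [map_smul, hz, smul_mul_assoc, smul_comm]
    have h2 := hΦΨ _ h1
    simpa [sub_eq_zero, Algebra.smul_def, pow_two, mul_assoc] using h2
  have := det_mul_eq_zero_of_lt ht (Matrix.of fun i s ↦ algebraMap A C (d (e₁ i) s))
    (Matrix.of fun s j ↦ Ψ (z s (e₂ j)))
  have hs := Matrix.det_smul (Matrix.of fun i j ↦ Ψ (N (e₁ i) (e₂ j))) (algebraMap A C h ^ 2)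
  rw [Fintype.card_fin] at hs
  rw [← this, ← hs]
  congr 1
  ext i j
  simp [Matrix.mul_apply, key]

-- Nakayama in the form without localization: generation modulo `m` becomes generation after
-- multiplication by an element congruent to `1` modulo `m`.
open scoped Pointwise in
lemma exists_smul_mem_span {A B : Type*} [CommRing A] [CommRing B] [Algebra A B]
    [Module.Finite A B] (m : Ideal A) (N : Submodule A B)
    (hN : ∀ x, ∃ y ∈ N, x - y ∈ m.map (algebraMap A B)) :
    ∃ h : A, h - 1 ∈ m ∧ ∀ x : B, h • x ∈ N := by
  obtain ⟨h, hm, hle⟩ := Submodule.exists_sub_one_mem_and_smul_le_of_fg_of_le_sup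
    (I := m) (N := N) (N' := ⊤) (P := ⊤) Module.Finite.fg_top le_rfl (by
      rintro x -
      obtain ⟨y, hy, hxy⟩ := hN x
      rw [Ideal.smul_top_eq_map, ← add_sub_cancel y x]
      exact Submodule.add_mem_sup hy hxy)
  exact ⟨h, hm, fun x ↦ hle (Submodule.smul_mem_pointwise_smul x h ⊤ trivial)⟩

/-- The bad `α` for each `y` form a proper `k`-subspace, and a vector space over an infinite field
is not a finite union of proper subspaces. -/
lemma exists_sum_smul_ne_zero {k κ Y : Type*} [Field k] [Infinite k] [Fintype κ] [Finite Y]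
    {K E : Y → Type*} [∀ y, Field (K y)] [∀ y, AddCommGroup (E y)] [∀ y, Module (K y) (E y)]
    (σ : ∀ y, k →+* K y) (x : ∀ y, κ → E y) (hx : ∀ y, ∃ a, x y a ≠ 0) :
    ∃ α : κ → k, ∀ y, ∑ a, σ y (α a) • x y a ≠ 0 := by
  classical
  by_contra! H
  let V (y : Y) : Subspace k (κ → k) :=
    { carrier := {α | ∑ a, σ y (α a) • x y a = 0}
      add_mem' := fun {α β} hα hβ ↦ by
        simp only [Set.mem_ofPred_eq] at hα hβ ⊢
        simp [add_smul, Finset.sum_add_distrib, hα, hβ]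
      zero_mem' := by simp
      smul_mem' := fun c α hα ↦ by
        simp only [Set.mem_ofPred_eq] at hα ⊢
        simp [mul_smul, ← Finset.smul_sum, hα] }
  obtain ⟨y, hy⟩ := Subspace.exists_eq_top_of_iUnion_eq_univ (p := V)
    (Set.eq_univ_of_forall fun α ↦ Set.mem_iUnion.mpr (H α))
  obtain ⟨a, ha⟩ := hx y
  have h1 : Pi.single a 1 ∈ V y := hy ▸ trivial
  have h2 : ∑ b, σ y ((Pi.single a 1 : κ → k) b) • x y b = 0 := h1
  rw [Finset.sum_eq_single a (fun b _ hb ↦ by simp [hb]) (by simp)] at h2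
  exact ha (by simpa using h2)

/-- A general linear combination of the entries of a matrix, with coefficients a matrix of rank
one, does not vanish at finitely many given points. -/
lemma exists_bilin_ne_zero {k R κ₁ κ₂ Y : Type*} [Field k] [Infinite k] [CommRing R] [Algebra k R]
    [Fintype κ₁] [Fintype κ₂] [Finite Y] {K : Y → Type*} [∀ y, Field (K y)]
    (ev : ∀ y, R →+* K y) (N : κ₁ → κ₂ → R) (hN : ∀ y, ∃ a b, ev y (N a b) ≠ 0) :
    ∃ (α : κ₁ → k) (β : κ₂ → k), ∀ y, ev y (∑ b, ∑ a,
      algebraMap k R (β b) * (algebraMap k R (α a) * N a b)) ≠ 0 := by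
  -- First `α` keeps the combined row, a vector in `κ₂ → K y`, nonzero at every `y`; then `β` does
  -- the same for the entries of this row.
  obtain ⟨α, hα⟩ := exists_sum_smul_ne_zero (k := k) (E := fun y ↦ κ₂ → K y)
    (fun y ↦ (ev y).comp (algebraMap k R)) (fun y a b ↦ ev y (N a b)) (fun y ↦ by
      obtain ⟨a, b, h⟩ := hN y
      exact ⟨a, fun h0 ↦ h (congrFun h0 b)⟩)
  obtain ⟨β, hβ⟩ := exists_sum_smul_ne_zero (k := k) (E := K)
    (fun y ↦ (ev y).comp (algebraMap k R))
    (fun y b ↦ ∑ a, ev y (algebraMap k R (α a)) * ev y (N a b)) (fun y ↦ by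
      by_contra! H
      refine hα y (funext fun b ↦ ?_)
      simpa using H b)
  refine ⟨α, β, fun y h0 ↦ hβ y ?_⟩
  simpa [Finset.mul_sum] using h0

end Algebra

/-! ### Local tests for vanishing. -/

section Vanishing

variable {k : Type u} [Field k] {ι : Type}

lemma eq_zero_of_openCover {T : Scheme.{u}} (𝒰 : T.OpenCover) {V : T.Opens} (s : Γ(T, V))
    (hs : ∀ i, ((𝒰.f i).app V).hom s = 0) : s = 0 := by
  apply T.IsSheaf.section_ext
  rintro x hxU
  obtain ⟨i, x, rfl⟩ := 𝒰.exists_eq x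
  refine ⟨𝒰.f i ''ᵁ 𝒰.f i ⁻¹ᵁ V, Set.image_preimage_subset (𝒰.f i) V, ⟨_, hxU, rfl⟩, ?_⟩
  apply ((𝒰.f i).appIso _).commRingCatIsoToRingEquiv.injective
  rw [map_zero, map_zero, ← RingEquiv.coe_toRingHom, Iso.commRingCatIsoToRingEquiv_toRingHom,
    Scheme.Hom.appIso_hom']
  rw [← RingHom.comp_apply, ← CommRingCat.hom_comp, Scheme.Hom.map_appLE]
  simpa [Scheme.Hom.appLE] using hs i

lemma eq_zero_of_locally_zero {T : Scheme.{u}} {V : T.Opens} (s : Γ(T, V))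
    (hs : ∀ t ∈ V, ∃ (V' : T.Opens) (h : V' ≤ V), t ∈ V' ∧
      (T.presheaf.map (homOfLE h).op).hom s = 0) : s = 0 := by
  apply T.IsSheaf.section_ext
  intro t ht
  obtain ⟨V', h, ht', h0⟩ := hs t ht
  exact ⟨V', h, ht', h0.trans (map_zero _).symm⟩

/-- As `g` need not be quasi-compact, its kernel is not known to be computed by sections on affine
opens. The claim is therefore tested on an affine cover of `T`, whose members map quasi-compactly.
-/
lemma zeroIdeal_le_ker {T : Scheme.{u}} (g : T ⟶ PSpace k ι) (S : Set (MvPolynomial ι k))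
    (h : ∀ f ∈ S, Vanishes g f) : zeroIdeal S ≤ g.ker := by
  refine Scheme.IdealSheafData.le_ofIdeals_iff.mpr fun U x hx ↦ ?_
  rw [RingHom.mem_ker]
  refine eq_zero_of_openCover T.affineCover _ fun i ↦ ?_
  have h1 : zeroIdeal S ≤ (T.affineCover.f i ≫ g).ker := by
    refine sInf_le fun f hf ↦ ?_
    have : CompactSpace (T.affineCover.X i) := by
      have : IsAffine (T.affineCover.X i) := inferInstance
      infer_instance
    rw [vanishes_subscheme_iff, ← vanishes_iff_ker]
    exact (h f hf).comp _
  have h2 := Scheme.Hom.ideal_ker_le _ _ (h1 U hx)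
  rw [RingHom.mem_ker, Scheme.Hom.comp_app] at h2
  exact h2

end Vanishing

/-! ### Trivializing `O(1)` by a nowhere vanishing linear form. -/

section Trivialization

variable {k : Type u} [Field k] {ι : Type}

lemma coordQuot_self (j : ι) : coordQuot (k := k) j j = 1 := by
  refine (congrArg (Proj.awayToSection (MvPolynomial.homogeneousSubmodule ι k)
    (MvPolynomial.X j)).hom (a₂ := 1) ?_).trans (map_one _)
  apply HomogeneousLocalization.val_injective
  rw [HomogeneousLocalization.Away.val_mk, HomogeneousLocalization.val_one,
    ← Localization.mk_one, Localization.mk_eq_mk_iff, Localization.r_iff_exists]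
  exact ⟨1, by simp⟩

lemma isUnit_coordQuot_res (j j' : ι) :
    IsUnit (((PSpace k ι).presheaf.map
      (homOfLE (inf_le_right : chart j ⊓ chart j' ≤ _)).op).hom (coordQuot j' j)) := by
  have h := coordQuot_res (k := k) j j' j'
  rw [coordQuot_self, map_one] at h
  exact IsUnit.of_mul_eq_one _ h.symm

/-- The nonvanishing locus of a form does not depend on the chart. -/
lemma chart_inf_basicOpen_le (j j' : ι) {f : MvPolynomial ι k} {d : ℕ} (hf : f.IsHomogeneous d) :
    chart j' ⊓ (PSpace k ι).basicOpen (dehom j f) ≤ (PSpace k ι).basicOpen (dehom j' f) := by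
  have h1 := congrArg (PSpace k ι).basicOpen (dehom_res j j' hf)
  rw [Scheme.basicOpen_mul, Scheme.basicOpen_res, Scheme.basicOpen_res,
    Scheme.basicOpen_of_isUnit _ ((isUnit_coordQuot_res j j').pow d)] at h1
  rintro y ⟨hy', hy⟩
  have hy0 : y ∈ chart j := Scheme.basicOpen_le _ _ hy
  exact (h1.ge ⟨⟨hy0, hy'⟩, ⟨⟨hy0, hy'⟩, hy⟩⟩).2

variable {T : Scheme.{u}}

/-- The pullback of functions on a chart of the projective space. -/
def pullChart (g : T ⟶ PSpace k ι) (W : T.Opens) (j : ι) :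
    Γ(PSpace k ι, chart j) →+* Γ(T, W ⊓ g ⁻¹ᵁ chart j) :=
  (g.appLE (chart j) _ inf_le_right).hom

/-- The restriction of functions to the preimage of a chart of the projective space. -/
def resChart (g : T ⟶ PSpace k ι) (W : T.Opens) (j : ι) :
    Γ(T, W) →+* Γ(T, W ⊓ g ⁻¹ᵁ chart j) :=
  (T.presheaf.map (homOfLE inf_le_left).op).hom

/-- The `k`-algebra structure on the functions on an open subset of a scheme over `k`. -/
def scalarsOn (t : T ⟶ Spec (.of k)) (W : T.Opens) : k →+* Γ(T, W) :=
  (T.presheaf.map (homOfLE le_top).op).hom.comp (scalars t)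

lemma appLE_comp_scalarsOn {T' : Scheme.{u}} (p : T' ⟶ T) (t : T ⟶ Spec (.of k))
    (W : T.Opens) (W' : T'.Opens) (h : W' ≤ p ⁻¹ᵁ W) :
    (p.appLE W W' h).hom.comp (scalarsOn t W) = scalarsOn (p ≫ t) W' := by
  have key : t.appTop ≫ T.presheaf.map (homOfLE (le_top : W ≤ ⊤)).op ≫ p.appLE W W' h =
      (p ≫ t).appTop ≫ T'.presheaf.map (homOfLE (le_top : W' ≤ ⊤)).op := by
    rw [Scheme.Hom.map_appLE, Scheme.Hom.comp_appTop, Category.assoc]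
    rfl
  exact congrArg (fun φ ↦ φ.hom.comp (Scheme.ΓSpecIso (.of k)).inv.hom) key

lemma scalarsOn_top (t : T ⟶ Spec (.of k)) : scalarsOn t ⊤ = scalars t := by
  ext x
  simp [scalarsOn]

lemma resChart_eq_zero (g : T ⟶ PSpace k ι) (W : T.Opens) {x : Γ(T, W)}
    (h : ∀ j, resChart g W j x = 0) : x = 0 := by
  refine eq_zero_of_locally_zero x fun t ht ↦ ?_
  have h1 : g t ∈ ⨆ j, chart (k := k) (ι := ι) j := iSup_chart.ge trivial
  obtain ⟨j, hj⟩ := TopologicalSpace.Opens.mem_iSup.mp h1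
  exact ⟨_, inf_le_left, ⟨ht, hj⟩, h j⟩

lemma pullChart_dehom (g : T ⟶ PSpace k ι) (W : T.Opens) (j : ι) (f : MvPolynomial ι k) :
    pullChart g W j (dehom j f) =
      MvPolynomial.eval₂ ((resChart g W j).comp (scalarsOn (g ≫ PSpace.str k ι) W))
        (fun i ↦ pullChart g W j (coordQuot j i)) f := by
  rw [dehom, MvPolynomial.coe_eval₂Hom, MvPolynomial.hom_eval₂]
  congr 1
  refine (appLE_comp_scalarsOn g (PSpace.str k ι) (chart j) (W ⊓ g ⁻¹ᵁ chart j)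
    inf_le_right).trans ?_
  rw [resChart, scalarsOn, scalarsOn, ← RingHom.comp_assoc, ← CommRingCat.hom_comp,
    ← Functor.map_comp]
  rfl

/-- The functions `ξ_i` are the quotients `x_i / ℓ` along the part over `W` of
`g : T ⟶ ℙ_k W`, where the linear form `ℓ` is nowhere zero. -/
structure IsTrivialization (g : T ⟶ PSpace k ι) (W : T.Opens) (ℓ : MvPolynomial ι k)
    (ξ : ι → Γ(T, W)) : Prop where
  isHomogeneous : ℓ.IsHomogeneous 1
  isUnit : ∀ j, IsUnit (pullChart g W j (dehom j ℓ))
  mul_res : ∀ j i, pullChart g W j (dehom j ℓ) * resChart g W j (ξ i) =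
    pullChart g W j (coordQuot j i)

lemma exists_isTrivialization (g : T ⟶ PSpace k ι) (W : T.Opens) {ℓ : MvPolynomial ι k}
    (hℓ : ℓ.IsHomogeneous 1)
    (h : ∀ y ∈ W, ∃ j, g y ∈ (PSpace k ι).basicOpen (dehom j ℓ)) :
    ∃ ξ, IsTrivialization g W ℓ ξ := by
  have hle (j : ι) : W ⊓ g ⁻¹ᵁ chart j ≤ g ⁻¹ᵁ (PSpace k ι).basicOpen (dehom j ℓ) := by
    rintro y ⟨hy, hyj⟩
    obtain ⟨j', hj'⟩ := h y hy
    exact chart_inf_basicOpen_le j' j hℓ ⟨hyj, hj'⟩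
  have hu (j : ι) : IsUnit (pullChart g W j (dehom j ℓ)) := by
    rw [pullChart, ← Scheme.Hom.map_appLE g (hle j) (homOfLE (Scheme.basicOpen_le _ (dehom j ℓ))).op,
      CommRingCat.hom_comp, RingHom.comp_apply]
    exact (RingedSpace.isUnit_res_basicOpen _ _).map _
  -- The function `x_i / ℓ` is glued from the products `(x_j / ℓ) * (x_i / x_j)`. On overlaps both
  -- `ℓ / x_j` and `x_i / x_j` change by the same unit `x_j / x_j'`.
  have hξ (i : ι) : ∃ x : Γ(T, W), ∀ j, resChart g W j x =
      Ring.inverse (pullChart g W j (dehom j ℓ)) * pullChart g W j (coordQuot j i) := by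
    refine (T.sheaf.existsUnique_gluing' (fun j ↦ W ⊓ g ⁻¹ᵁ chart j) W
      (fun j ↦ homOfLE inf_le_left) ?_
      (fun j ↦ Ring.inverse (pullChart g W j (dehom j ℓ)) *
        pullChart g W j (coordQuot j i)) ?_).exists
    · intro y hy
      have h1 : g y ∈ ⨆ j, chart (k := k) (ι := ι) j := iSup_chart.ge trivial
      obtain ⟨j, hj⟩ := TopologicalSpace.Opens.mem_iSup.mp h1
      exact TopologicalSpace.Opens.mem_iSup.mpr ⟨j, hy, hj⟩
    · intro j j'
      let O := (W ⊓ g ⁻¹ᵁ chart j) ⊓ (W ⊓ g ⁻¹ᵁ chart j')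
      have hO : O ≤ g ⁻¹ᵁ (chart j ⊓ chart j') := fun y hy ↦ ⟨hy.1.2, hy.2.2⟩
      let r₁ := (T.presheaf.map (homOfLE (inf_le_left : O ≤ W ⊓ g ⁻¹ᵁ chart j)).op).hom
      let r₂ := (T.presheaf.map (homOfLE (inf_le_right : O ≤ W ⊓ g ⁻¹ᵁ chart j')).op).hom
      let γ := (g.appLE (chart j ⊓ chart j') O hO).hom
      have e₁ : γ.comp ((PSpace k ι).presheaf.map (homOfLE inf_le_left).op).hom =
          r₁.comp (pullChart g W j) := by
        simp only [γ, r₁, pullChart, ← CommRingCat.hom_comp, Scheme.Hom.map_appLE,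
          Scheme.Hom.appLE_map]
        rfl
      have e₂ : γ.comp ((PSpace k ι).presheaf.map (homOfLE inf_le_right).op).hom =
          r₂.comp (pullChart g W j') := by
        simp only [γ, r₂, pullChart, ← CommRingCat.hom_comp, Scheme.Hom.map_appLE,
          Scheme.Hom.appLE_map]
        rfl
      have h₁ := congrArg γ (dehom_res j j' hℓ)
      have h₂ := congrArg γ (coordQuot_res (k := k) j j' i)
      rw [pow_one, map_mul] at h₁
      rw [map_mul] at h₂
      rw [← RingHom.comp_apply, e₂] at h₁ h₂
      rw [← RingHom.comp_apply _ _ (dehom j ℓ), e₁] at h₁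
      rw [← RingHom.comp_apply _ _ (coordQuot j i), e₁] at h₂
      change r₁ _ = r₂ _
      have h₃ : r₁ (pullChart g W j (dehom j ℓ)) * r₁ (Ring.inverse (pullChart g W j (dehom j ℓ)) *
          pullChart g W j (coordQuot j i)) = r₁ (pullChart g W j (coordQuot j i)) := by
        rw [← map_mul, ← mul_assoc, Ring.mul_inverse_cancel _ (hu j), one_mul]
      have h₄ : r₂ (pullChart g W j' (dehom j' ℓ)) *
          r₂ (Ring.inverse (pullChart g W j' (dehom j' ℓ)) * pullChart g W j' (coordQuot j' i)) =
          r₂ (pullChart g W j' (coordQuot j' i)) := by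
        rw [← map_mul, ← mul_assoc, Ring.mul_inverse_cancel _ (hu j'), one_mul]
      apply ((hu j').map r₂).mul_left_cancel
      rw [h₄]
      refine (congrArg (· * _) h₁).trans (Eq.trans ?_ h₂.symm)
      exact (mul_assoc _ _ _).trans (congrArg _ h₃)
  choose ξ hξ using hξ
  refine ⟨ξ, hℓ, hu, fun j i ↦ ?_⟩
  rw [hξ, ← mul_assoc, Ring.mul_inverse_cancel _ (hu j), one_mul]

namespace IsTrivialization

variable {g : T ⟶ PSpace k ι} {W : T.Opens} {ℓ : MvPolynomial ι k} {ξ : ι → Γ(T, W)}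

/-- This is `f / x_j ^ d = (ℓ / x_j) ^ d * (f / ℓ ^ d)`. The coefficient ring is arbitrary because
both `k` and the functions on an open subset of the base are needed. -/
lemma eval₂_coordQuot (h : IsTrivialization g W ℓ ξ) {A : Type*} [CommRing A]
    (φ : A →+* Γ(T, W)) (j : ι) {f : MvPolynomial ι A} {d : ℕ} (hf : f.IsHomogeneous d) :
    MvPolynomial.eval₂ ((resChart g W j).comp φ) (fun i ↦ pullChart g W j (coordQuot j i)) f =
      pullChart g W j (dehom j ℓ) ^ d * resChart g W j (MvPolynomial.eval₂ φ ξ f) := by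
  rw [MvPolynomial.hom_eval₂, ← eval₂_smul_of_isHomogeneous _ _ _ hf]
  exact congrArg (fun v ↦ MvPolynomial.eval₂ _ v f) (funext fun i ↦ (h.mul_res j i).symm)

lemma pullChart_dehom (h : IsTrivialization g W ℓ ξ) (j : ι) {f : MvPolynomial ι k} {d : ℕ}
    (hf : f.IsHomogeneous d) :
    pullChart g W j (dehom j f) = pullChart g W j (dehom j ℓ) ^ d *
      resChart g W j (MvPolynomial.eval₂ (scalarsOn (g ≫ PSpace.str k ι) W) ξ f) := by
  rw [CactusScheme.pullChart_dehom, h.eval₂_coordQuot _ j hf]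

lemma eval₂_self (h : IsTrivialization g W ℓ ξ) :
    MvPolynomial.eval₂ (scalarsOn (g ≫ PSpace.str k ι) W) ξ ℓ = 1 := by
  rw [← sub_eq_zero]
  refine resChart_eq_zero g W fun j ↦ ?_
  have h1 := h.pullChart_dehom j h.isHomogeneous
  rw [pow_one] at h1
  rw [map_sub, map_one, sub_eq_zero]
  exact (h.isUnit j).mul_left_cancel (h1.symm.trans (mul_one _).symm)

lemma eval₂_eq_zero (h : IsTrivialization g W ℓ ξ) {f : MvPolynomial ι k} {d : ℕ}
    (hf : f.IsHomogeneous d) (hgf : Vanishes g f) :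
    MvPolynomial.eval₂ (scalarsOn (g ≫ PSpace.str k ι) W) ξ f = 0 := by
  refine resChart_eq_zero g W fun j ↦ ?_
  have h1 := h.pullChart_dehom j hf
  have h2 : pullChart g W j (dehom j f) = 0 := by
    rw [pullChart, Scheme.Hom.appLE, CommRingCat.hom_comp, RingHom.comp_apply]
    exact (congrArg _ (hgf j)).trans (map_zero _)
  rw [h2] at h1
  exact (((h.isUnit j).pow d).mul_right_eq_zero).mp h1.symm

/-- A form with a vanishing restriction along `p : T' ⟶ W` vanishes along `p ≫ g`. -/
lemma vanishes_comp (h : IsTrivialization g W ℓ ξ) {T' : Scheme.{u}} (p : T' ⟶ T)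
    (hp : ⊤ ≤ p ⁻¹ᵁ W) {f : MvPolynomial ι k} {d : ℕ} (hf : f.IsHomogeneous d)
    (h0 : (p.appLE W ⊤ hp).hom
      (MvPolynomial.eval₂ (scalarsOn (g ≫ PSpace.str k ι) W) ξ f) = 0) :
    Vanishes (p ≫ g) f := by
  intro j
  have hle : (p ≫ g) ⁻¹ᵁ chart j ≤ p ⁻¹ᵁ (W ⊓ g ⁻¹ᵁ chart j) :=
    fun y hy ↦ ⟨hp trivial, hy⟩
  have h1 : (p ≫ g).app (chart j) =
      g.appLE (chart j) (W ⊓ g ⁻¹ᵁ chart j) inf_le_right ≫ p.appLE _ _ hle := by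
    rw [Scheme.Hom.appLE_comp_appLE, Scheme.Hom.app_eq_appLE]
  have h2 : (p.appLE _ _ hle).hom (resChart g W j
      (MvPolynomial.eval₂ (scalarsOn (g ≫ PSpace.str k ι) W) ξ f)) = 0 := by
    rw [resChart, ← RingHom.comp_apply, ← CommRingCat.hom_comp, Scheme.Hom.map_appLE,
      ← Scheme.Hom.appLE_map p hp (homOfLE le_top).op, CommRingCat.hom_comp, RingHom.comp_apply,
      h0, map_zero]
  have h3 := h.pullChart_dehom j hf
  rw [h1, CommRingCat.hom_comp, RingHom.comp_apply]
  refine (congrArg _ h3).trans ?_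
  rw [map_mul, h2, mul_zero]

end IsTrivialization

end Trivialization

/-! ### Independence as surjectivity of restriction of linear forms. -/

section Independence

variable {k : Type u} [Field k] {ι : Type} [Fintype ι]

/-- If the length of `R` is the dimension of its linear span then the linear forms, restricted to
`R`, generate the functions on `R`. -/
lemma exists_basis_of_isIndependent {R : Scheme.{u}} {g : R ⟶ PSpace k ι} (hg : IsIndependent g)
    (x : ι → Γ(R, ⊤))
    (hx : ∀ c : ι → k, ∑ i, scalars (g ≫ PSpace.str k ι) (c i) * x i = 0 →
      Vanishes g (∑ i, MvPolynomial.C (c i) * MvPolynomial.X i)) {n : ℕ}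
    (hn : length (g ≫ PSpace.str k ι) = n) :
    ∃ c : Fin n → ι → k, ∀ y, ∃ γ : Fin n → k,
      y = ∑ s, scalars (g ≫ PSpace.str k ι) (γ s) *
        ∑ i, scalars (g ≫ PSpace.str k ι) (c s i) * x i := by
  let _ : Algebra k Γ(R, ⊤) := (scalars (g ≫ PSpace.str k ι)).toAlgebra
  have hfin : Module.Finite k Γ(R, ⊤) := by
    have := hg.1
    have h1 := Scheme.Hom.finite_appTop (g ≫ PSpace.str k ι)
    exact h1.comp (RingHom.Finite.of_surjective _
      (ConcreteCategory.bijective_of_isIso (Scheme.ΓSpecIso (.of k)).inv).2)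
  let Θ : (ι → k) →ₗ[k] Γ(R, ⊤) := Fintype.linearCombination k x
  have hΘ (c : ι → k) : Θ c = ∑ i, scalars (g ≫ PSpace.str k ι) (c i) * x i := by
    simp only [Θ, Fintype.linearCombination_apply, Algebra.smul_def]
    rfl
  have hn' : Module.finrank k Γ(R, ⊤) = n := hn
  have hspan : Module.finrank k Γ(R, ⊤) = Module.finrank k (affineSpan g) := hg.2
  -- The coefficient vectors in `ker Θ` are linear forms vanishing on `R`, so the span pairs to zero
  -- with them.
  let D : affineSpan g →ₗ[k] (LinearMap.ker Θ).dualAnnihilator :=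
    { toFun := fun w ↦ ⟨∑ i, w.1 i • LinearMap.proj i, by
        rw [Submodule.mem_dualAnnihilator]
        intro c hc
        have := w.2 c (hx c (by rw [← hΘ]; exact hc))
        simpa [mul_comm] using this⟩
      map_add' := fun v w ↦ by
        ext
        simp [add_mul, Finset.sum_add_distrib]
      map_smul' := fun a w ↦ by
        ext
        simp [mul_assoc, Finset.mul_sum] }
  have hD : Function.Injective D := by
    classical
    intro v w hvw
    ext i
    have := congrArg (fun φ ↦ φ.1 (Pi.single i 1)) hvw
    simpa [D, Pi.single_apply] using this
  have h1 := LinearMap.finrank_le_finrank_of_injective hD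
  have h2 := Subspace.finrank_add_finrank_dualAnnihilator_eq (LinearMap.ker Θ)
  have h3 := LinearMap.finrank_range_add_finrank_ker Θ
  -- The length equals the dimension of the span, which by `D` is at most `dim W - dim (ker Θ)`, the
  -- rank of `Θ`.
  have hsurj : LinearMap.range Θ = ⊤ :=
    Submodule.eq_top_of_finrank_eq (le_antisymm (Submodule.finrank_le _) (by omega))
  let bas := Module.finBasisOfFinrankEq k Γ(R, ⊤) hn'
  choose c hc using fun s ↦ LinearMap.range_eq_top.mp hsurj (bas s)
  refine ⟨c, fun y ↦ ⟨bas.repr y, ?_⟩⟩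
  conv_lhs => rw [← bas.sum_repr y]
  refine Finset.sum_congr rfl fun s _ ↦ ?_
  rw [← hΘ, hc, Algebra.smul_def]
  rfl

end Independence

/-! ### Functions vanishing on the fibre over a `k`-point. -/

section Fibre

variable {k : Type u} [Field k]

/-- With `I` the extension of the ideal of `s`, the spectrum of the quotient by `I` maps to the
fibre. A function vanishing on the fibre therefore vanishes modulo `I`; no identification of the
fibre with this spectrum is needed. -/
lemma mem_map_ker_of_fibre {R Q : Scheme.{u}} (π : R ⟶ Q) [IsAffineHom π]
    (q : Q ⟶ Spec (.of k)) (s : Spec (.of k) ⟶ Q) (hs : s ≫ q = 𝟙 _) {U : Q.Opens}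
    (hU : IsAffineOpen U) (hsU : ⊤ ≤ s ⁻¹ᵁ U)
    (hp : ⊤ ≤ (pullback.fst π s) ⁻¹ᵁ π ⁻¹ᵁ U) (b : Γ(R, π ⁻¹ᵁ U))
    (hb : ((pullback.fst π s).appLE (π ⁻¹ᵁ U) ⊤ hp).hom b = 0) :
    b ∈ (RingHom.ker (s.appLE U ⊤ hsU).hom).map (π.app U).hom := by
  let I := (RingHom.ker (s.appLE U ⊤ hsU).hom).map (π.app U).hom
  have hW : IsAffineOpen (π ⁻¹ᵁ U) := hU.preimage π
  let mk : Γ(R, π ⁻¹ᵁ U) ⟶ .of (Γ(R, π ⁻¹ᵁ U) ⧸ I) := CommRingCat.ofHom (Ideal.Quotient.mk I)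
  let δ : CommRingCat.of k ⟶ .of (Γ(R, π ⁻¹ᵁ U) ⧸ I) :=
    CommRingCat.ofHom (mk.hom.comp ((π.app U).hom.comp (scalarsOn q U)))
  let ψ : Γ(Q, U) ⟶ CommRingCat.of k := s.appLE U ⊤ hsU ≫ (Scheme.ΓSpecIso (.of k)).hom
  have hsψ : Spec.map ψ ≫ hU.fromSpec = s := by
    have h1 := hU.SpecMap_appLE_fromSpec s (isAffineOpen_top _) hsU
    rw [IsAffineOpen.fromSpec_top, Iso.eq_inv_comp, Scheme.isoSpec_Spec_hom] at h1
    rw [Spec.map_comp, Category.assoc, h1]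
  have hψ (c : k) : ψ.hom (scalarsOn q U c) = c := by
    have h1 : (s.appLE U ⊤ hsU).hom.comp (scalarsOn q U) = scalarsOn (𝟙 _) ⊤ := by
      rw [appLE_comp_scalarsOn, hs]
    have h2 := congrArg (fun φ ↦ (Scheme.ΓSpecIso (.of k)).hom.hom (φ c)) h1
    refine Eq.trans h2 ?_
    simp [scalarsOn, scalars]
  -- A function on `U` differs from its value at `s` by an element of the ideal of `s`, because `s`
  -- is a section of `q`.
  have hψδ : π.app U ≫ mk = ψ ≫ δ := by
    ext x
    change Ideal.Quotient.mk I _ = Ideal.Quotient.mk I _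
    rw [Ideal.Quotient.eq, RingHom.comp_apply]
    change (π.app U).hom x - _ ∈ I
    rw [← map_sub]
    refine Ideal.mem_map_of_mem _ ?_
    rw [RingHom.mem_ker]
    apply (ConcreteCategory.bijective_of_isIso (Scheme.ΓSpecIso (.of k)).hom).1
    change ψ.hom _ = _
    rw [map_sub]
    refine ((sub_eq_zero.mpr (hψ _).symm).trans (map_zero _).symm)
  have comm : (Spec.map mk ≫ hW.fromSpec) ≫ π = Spec.map δ ≫ s := by
    have h1 := hU.SpecMap_appLE_fromSpec π hW le_rfl
    rw [Category.assoc, ← h1, Scheme.Hom.appLE_eq_app, ← Category.assoc, ← Spec.map_comp, hψδ,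
      Spec.map_comp, Category.assoc, hsψ]
  let l := pullback.lift _ _ comm
  have hl : l ≫ pullback.fst π s = Spec.map mk ≫ hW.fromSpec := pullback.lift_fst _ _ _
  have h0 : ((l ≫ pullback.fst π s).appLE (π ⁻¹ᵁ U) ⊤ (fun _ _ ↦ hp (TopologicalSpace.Opens.mem_top _))).hom b = 0 := by
    rw [← Scheme.Hom.appLE_comp_appLE l (pullback.fst π s) (π ⁻¹ᵁ U) ⊤ ⊤ hp le_top,
      CommRingCat.hom_comp, RingHom.comp_apply, hb, map_zero]
  have h1 : (Spec.map mk ≫ hW.fromSpec).appLE (π ⁻¹ᵁ U) ⊤ (by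
      rw [← hl]
      exact fun _ _ ↦ hp (TopologicalSpace.Opens.mem_top _)) = mk ≫ (Scheme.ΓSpecIso _).inv := by
    rw [Scheme.Hom.comp_appLE, hW.fromSpec_app_self, Category.assoc]
    refine (congrArg ((Scheme.ΓSpecIso _).inv ≫ ·)
      (Scheme.Hom.map_appLE (Spec.map mk) _ _)).trans ?_
    rw [Scheme.ΓSpecIso_inv_naturality, Scheme.Hom.appTop, Scheme.Hom.app_eq_appLE]
    rfl
  simp only [hl] at h0
  rw [h1] at h0
  have h2 : mk.hom b = 0 := by
    apply (ConcreteCategory.bijective_of_isIso (Scheme.ΓSpecIso (.of (Γ(R, π ⁻¹ᵁ U) ⧸ I))).inv).1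
    exact h0.trans (map_zero _).symm
  exact Ideal.Quotient.eq_zero_iff_mem.mp h2

end Fibre

/-! ### Rank-one matrices and linear generators along a finite family. -/

section Families

variable {k : Type u} [Field k] {ι : Type}

/-- A bilinear form in the rows and the columns of a matrix of linear forms. -/
def bilinForm {κ₁ κ₂ : Type} [Fintype κ₁] [Fintype κ₂] (M : Matrix κ₁ κ₂ (MvPolynomial ι k))
    (α : κ₁ → k) (β : κ₂ → k) : MvPolynomial ι k :=
  ∑ b, ∑ a, MvPolynomial.C (β b) * (MvPolynomial.C (α a) * M a b)

lemma isHomogeneous_bilinForm {κ₁ κ₂ : Type} [Fintype κ₁] [Fintype κ₂]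
    {M : Matrix κ₁ κ₂ (MvPolynomial ι k)} (hM : ∀ a b, (M a b).IsHomogeneous 1)
    (α : κ₁ → k) (β : κ₂ → k) : (bilinForm M α β).IsHomogeneous 1 := by
  refine MvPolynomial.IsHomogeneous.sum _ _ _ fun b _ ↦
    MvPolynomial.IsHomogeneous.sum _ _ _ fun a _ ↦ ?_
  have h1 := (MvPolynomial.isHomogeneous_C ι (β b)).mul
    ((MvPolynomial.isHomogeneous_C ι (α a)).mul (hM a b))
  simpa using h1

lemma exists_bilinForm {κ₁ κ₂ : Type} [Fintype κ₁] [Fintype κ₂] [Infinite k]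
    (M : Matrix κ₁ κ₂ (MvPolynomial ι k)) {Y : Set (PSpace k ι)} (hY : Y.Finite)
    (hne : ∀ y ∈ Y, ∃ j a b, y ∈ (PSpace k ι).basicOpen (dehom j (M a b))) :
    ∃ α β, ∀ y ∈ Y, ∃ j, y ∈ (PSpace k ι).basicOpen (dehom j (bilinForm M α β)) := by
  have : Finite Y := hY
  choose j a b h using fun y : Y ↦ hne y.1 y.2
  have hj (y : Y) : y.1 ∈ chart (j y) := Scheme.basicOpen_le _ _ (h y)
  obtain ⟨α, β, H⟩ := exists_bilin_ne_zero (k := k) (Y := Y)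
    (fun y ↦ ((PSpace k ι).evaluation (chart (j y)) y.1 (hj y)).hom.comp (dehom (j y))) M
    (fun y ↦ ⟨a y, b y,
      ((PSpace k ι).evaluation_ne_zero_iff_mem_basicOpen y.1 (hj y) _).mpr (h y)⟩)
  exact ⟨α, β, fun y hy ↦ ⟨j ⟨y, hy⟩,
    ((PSpace k ι).evaluation_ne_zero_iff_mem_basicOpen y (hj ⟨y, hy⟩) _).mp (H ⟨y, hy⟩)⟩⟩

/-- An affine neighbourhood `U` of a point `s` such that a fixed general bilinear form in the rows
and columns of `M` vanishes nowhere on the preimage of `U`. -/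
lemma exists_affine_nbhd {κ₁ κ₂ : Type} [Fintype κ₁] [Fintype κ₂] [Infinite k]
    (M : Matrix κ₁ κ₂ (MvPolynomial ι k)) {R Q : Scheme.{u}} (π : R ⟶ Q) [IsFinite π]
    (g : R ⟶ PSpace k ι)
    (hne : ∀ y, ∃ j a b, g y ∈ (PSpace k ι).basicOpen (dehom j (M a b))) (s : Q) :
    ∃ (α : κ₁ → k) (β : κ₂ → k) (U : Q.Opens), IsAffineOpen U ∧ s ∈ U ∧
      ∀ y ∈ π ⁻¹ᵁ U, ∃ j, g y ∈ (PSpace k ι).basicOpen (dehom j (bilinForm M α β)) := by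
  obtain ⟨α, β, H⟩ := exists_bilinForm M
    (Y := g '' (π ⁻¹' {s})) ((π.finite_preimage_singleton s).image _) (by
      rintro _ ⟨y, -, rfl⟩
      exact hne y)
  let O : R.Opens := g ⁻¹ᵁ ⨆ j, (PSpace k ι).basicOpen (dehom j (bilinForm M α β))
  have hO (y : R) : y ∈ O ↔ ∃ j, g y ∈ (PSpace k ι).basicOpen (dehom j (bilinForm M α β)) :=
    TopologicalSpace.Opens.mem_iSup
  -- A finite morphism is closed, so nonvanishing on the fibre over `s` spreads to the preimage of a
  -- neighbourhood of `s`.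
  have hcl : IsClosed (π '' (O : Set R)ᶜ) := π.isClosedMap _ O.isOpen.isClosed_compl
  obtain ⟨_, ⟨U, hU, rfl⟩, hsU, hUO⟩ := Q.isBasis_affineOpens.exists_subset_of_mem_open
    (show s ∈ (π '' (O : Set R)ᶜ)ᶜ by
      rintro ⟨y, hy, rfl⟩
      exact hy ((hO y).mpr (H _ ⟨y, rfl, rfl⟩))) hcl.isOpen_compl
  refine ⟨α, β, U, hU, hsU, fun y hy ↦ (hO y).mp ?_⟩
  by_contra hy'
  exact hUO hy ⟨y, hy', rfl⟩

/-- If the `2 × 2` minors of `M` vanish then `M` is the product of a column and a row, both of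
which are general combinations of the columns and rows of `M`. -/
lemma eval₂_entry_eq_mul {κ₁ κ₂ : Type} [Fintype κ₁] [Fintype κ₂]
    {M : Matrix κ₁ κ₂ (MvPolynomial ι k)} {B : Type*} [CommRing B] (f : MvPolynomial ι k →+* B)
    (h2 : ∀ m ∈ minors M 2, f m = 0) (α : κ₁ → k) (β : κ₂ → k) (h1 : f (bilinForm M α β) = 1)
    (a : κ₁) (b : κ₂) :
    f (M a b) = (∑ b', f (MvPolynomial.C (β b')) * f (M a b')) *
      ∑ a', f (MvPolynomial.C (α a')) * f (M a' b) := by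
  have hm (a' : κ₁) (b' : κ₂) : f (M a b) * f (M a' b') = f (M a b') * f (M a' b) := by
    have := h2 _ ⟨![a, a'], ![b, b'], rfl⟩
    rw [Matrix.det_fin_two] at this
    simpa [sub_eq_zero] using this
  -- Multiply the entry by `1 = f (bilinForm M α β)`, then exchange columns term by term with the `2
  -- × 2` minors.
  rw [← mul_one (f (M a b)), ← h1, bilinForm, map_sum, Finset.mul_sum, Finset.sum_mul]
  refine Finset.sum_congr rfl fun b' _ ↦ ?_
  rw [map_sum, Finset.mul_sum, Finset.mul_sum]
  refine Finset.sum_congr rfl fun a' _ ↦ ?_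
  rw [map_mul, map_mul]
  linear_combination f (MvPolynomial.C (β b')) * f (MvPolynomial.C (α a')) * hm a' b'

lemma FiniteFamily.toAmbient_str {X : Scheme.{u}} {i : X ⟶ PSpace k ι} (F : FiniteFamily i) :
    F.toAmbient ≫ PSpace.str k ι = F.toBase ≫ F.str := by
  rw [FiniteFamily.toAmbient, FiniteFamily.toBase, Category.assoc, Category.assoc,
    Category.assoc, pullback.condition]

variable [Fintype ι]

/-- Locally around a `k`-point of the base, the functions on an independent family of degree `n`
are generated by `n` linear forms. -/
lemma exists_linear_generators {X : Scheme.{u}} {i : X ⟶ PSpace k ι} (F : FiniteFamily i) {n : ℕ}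
    (hdeg : F.HasDegree n) (hind : F.Independent) (s : Spec (.of k) ⟶ F.Q) (hs : s ≫ F.str = 𝟙 _)
    {U : F.Q.Opens} (hU : IsAffineOpen U) (hsU : ⊤ ≤ s ⁻¹ᵁ U) {ℓ : MvPolynomial ι k}
    {ξ : ι → Γ(F.R, F.toBase ⁻¹ᵁ U)}
    (hξ : IsTrivialization F.toAmbient (F.toBase ⁻¹ᵁ U) ℓ ξ) :
    letI : Algebra Γ(F.Q, U) Γ(F.R, F.toBase ⁻¹ᵁ U) := (F.toBase.app U).hom.toAlgebra
    ∃ (c : Fin n → ι → k) (h : Γ(F.Q, U)), (s.appLE U ⊤ hsU).hom h = 1 ∧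
      ∀ x : Γ(F.R, F.toBase ⁻¹ᵁ U), h • x ∈ Submodule.span Γ(F.Q, U)
        (Set.range fun t ↦ ∑ l, scalarsOn F.str U (c t l) • ξ l) := by
  let _ : Algebra Γ(F.Q, U) Γ(F.R, F.toBase ⁻¹ᵁ U) := (F.toBase.app U).hom.toAlgebra
  have hfinite : IsFinite F.toBase := F.isFinite
  have hmodfin : Module.Finite Γ(F.Q, U) Γ(F.R, F.toBase ⁻¹ᵁ U) :=
    IsFinite.finite_app (f := F.toBase) U hU
  have htoStr := F.toAmbient_str
  have hstr : F.fibre s ≫ PSpace.str k ι = pullback.snd F.toBase s := by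
    rw [FiniteFamily.fibre, Category.assoc, htoStr, ← Category.assoc, pullback.condition,
      Category.assoc, hs, Category.comp_id]
  have hp : ⊤ ≤ (pullback.fst F.toBase s) ⁻¹ᵁ F.toBase ⁻¹ᵁ U := by
    rw [← Scheme.Hom.comp_preimage, pullback.condition]
    exact fun y _ ↦ hsU trivial
  let ρ := ((pullback.fst F.toBase s).appLE (F.toBase ⁻¹ᵁ U) ⊤ hp).hom
  have hρ : ρ.comp (scalarsOn (F.toAmbient ≫ PSpace.str k ι) (F.toBase ⁻¹ᵁ U)) =
      scalars (F.fibre s ≫ PSpace.str k ι) := by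
    rw [appLE_comp_scalarsOn, ← scalarsOn_top]
    rfl
  have hτ (z : k) : scalarsOn (F.toAmbient ≫ PSpace.str k ι) (F.toBase ⁻¹ᵁ U) z =
      algebraMap Γ(F.Q, U) Γ(F.R, F.toBase ⁻¹ᵁ U) (scalarsOn F.str U z) := by
    rw [htoStr, ← appLE_comp_scalarsOn F.toBase F.str U _ le_rfl, Scheme.Hom.appLE_eq_app]
    rfl
  -- The basis on the fibre consists of linear forms with coefficients in `k`, so it lifts to the
  -- family with the same coefficients.
  obtain ⟨c, hc⟩ := exists_basis_of_isIndependent (hind s hs) (fun l ↦ ρ (ξ l)) (fun c hc ↦ by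
    refine hξ.vanishes_comp (d := 1) _ hp (MvPolynomial.IsHomogeneous.sum _ _ _ fun l _ ↦ ?_) ?_
    · simpa using (MvPolynomial.isHomogeneous_C ι (c l)).mul (MvPolynomial.isHomogeneous_X k l)
    · rw [← hc]
      simp only [MvPolynomial.eval₂_sum, MvPolynomial.eval₂_mul, MvPolynomial.eval₂_C,
        MvPolynomial.eval₂_X, map_sum, map_mul, ← hρ]
      rfl) (hstr ▸ hdeg s hs)
  obtain ⟨h, hm, hspan⟩ := exists_smul_mem_span (RingHom.ker (s.appLE U ⊤ hsU).hom)
    (Submodule.span Γ(F.Q, U) (Set.range fun t ↦ ∑ l, scalarsOn F.str U (c t l) • ξ l))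
    (fun x ↦ by
      obtain ⟨γ, hγ⟩ := hc (ρ x)
      refine ⟨∑ t, scalarsOn F.str U (γ t) • ∑ l, scalarsOn F.str U (c t l) • ξ l,
        Submodule.sum_mem _ fun t _ ↦ Submodule.smul_mem _ _ (Submodule.subset_span ⟨t, rfl⟩), ?_⟩
      refine mem_map_ker_of_fibre F.toBase F.str s hs hU hsU hp _ ?_
      change ρ _ = 0
      rw [map_sub, hγ, sub_eq_zero, ← hρ]
      simp only [Algebra.smul_def, ← hτ, map_sum, map_mul]
      rfl)
  refine ⟨c, h, ?_, hspan⟩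
  rw [RingHom.mem_ker, map_sub, map_one, sub_eq_zero] at hm
  exact hm

end Families

/-! ### Minors on the linear span. -/

section LinearSpan

variable {k : Type u} [Field k] {ι : Type}

lemma vanishesOver_of_eval₂_eq_zero {X : Scheme.{u}} {i : X ⟶ PSpace k ι} (F : FiniteFamily i)
    {U : F.Q.Opens} {ℓ : MvPolynomial ι k} {ξ : ι → Γ(F.R, F.toBase ⁻¹ᵁ U)}
    (hξ : IsTrivialization F.toAmbient (F.toBase ⁻¹ᵁ U) ℓ ξ) {f : MvPolynomial ι Γ(F.Q, U)} {d : ℕ}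
    (hf : f.IsHomogeneous d) (h0 : MvPolynomial.eval₂ (F.toBase.app U).hom ξ f = 0) :
    VanishesOver F.toBase F.toAmbient U f := by
  intro j
  have h1 := hξ.eval₂_coordQuot (F.toBase.app U).hom j hf
  rw [h0, map_zero, mul_zero] at h1
  exact h1

variable [Fintype ι]

/-- The minors of `M` of size bigger than the degree of an independent family along which `M` has
rank one vanish along every subscheme of the linear span of the family. -/
lemma vanishes_minor {κ₁ κ₂ : Type} [Fintype κ₁] [Fintype κ₂] [Infinite k]
    {M : Matrix κ₁ κ₂ (MvPolynomial ι k)} (hM : ∀ a b, (M a b).IsHomogeneous 1)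
    {X : Scheme.{u}} {i : X ⟶ PSpace k ι} (F : FiniteFamily i) {n : ℕ}
    (hdeg : F.HasDegree n) (hind : F.Independent)
    (h2 : ∀ m ∈ minors M 2, Vanishes F.toAmbient m)
    (hne : ∀ y, ∃ j a b, F.toAmbient y ∈ (PSpace k ι).basicOpen (dehom j (M a b)))
    {T : Scheme.{u}} (a : T ⟶ F.Q) (g : T ⟶ PSpace k ι) (hag : a ≫ F.str = g ≫ PSpace.str k ι)
    (hT : ∀ (U : F.Q.affineOpens) (f : MvPolynomial ι Γ(F.Q, U)), f.IsHomogeneous 1 →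
      VanishesOver F.toBase F.toAmbient U f → VanishesOver a g U f)
    {t : ℕ} (ht : n < t) {m : MvPolynomial ι k} (hm : m ∈ minors M t) : Vanishes g m := by
  intro j
  refine eq_zero_of_locally_zero _ fun y hy ↦ ?_
  -- Degree and independence are known only at `k`-points, so `a y` is replaced by a `k`-point `s`
  -- in its closure: every neighbourhood of `s` contains `a y`.
  obtain ⟨s, hs, hcl⟩ := F.enough.2 (a y)
  have hfinite : IsFinite F.toBase := F.isFinite
  let pt : Spec (.of k) := IsLocalRing.closedPoint k
  have hgen (O : F.Q.Opens) (hO : s pt ∈ O) : a y ∈ O := by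
    obtain ⟨_, h1, rfl⟩ := mem_closure_iff.mp (hcl ⟨pt, rfl⟩) O O.isOpen hO
    exact h1
  obtain ⟨α, β, U, hU, hptU, hℓ⟩ := exists_affine_nbhd M F.toBase F.toAmbient hne (s pt)
  have hsU : ⊤ ≤ s ⁻¹ᵁ U := fun z _ ↦ by
    have : z = pt := Subsingleton.elim (α := PrimeSpectrum k) z pt
    exact this ▸ hptU
  obtain ⟨ξ, hξ⟩ := exists_isTrivialization F.toAmbient (F.toBase ⁻¹ᵁ U)
    (isHomogeneous_bilinForm hM α β) hℓ
  let _ : Algebra Γ(F.Q, U) Γ(F.R, F.toBase ⁻¹ᵁ U) := (F.toBase.app U).hom.toAlgebra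
  obtain ⟨c, h, hh1, hh⟩ := exists_linear_generators F hdeg hind s hs hU hsU hξ
  let V : T.Opens := a ⁻¹ᵁ U ⊓ g ⁻¹ᵁ chart j
  let _ : Algebra Γ(F.Q, U) Γ(T, V) := (a.appLE U V inf_le_left).hom.toAlgebra
  let w (l : ι) : Γ(T, V) := pullChart g (a ⁻¹ᵁ U) j (coordQuot j l)
  -- `Φ` divides a linear form by `ℓ` and restricts it to the family; `Ψ` divides it by `x_j` and
  -- restricts it to `T`.
  let Φ : MvPolynomial.homogeneousSubmodule ι Γ(F.Q, U) 1 →ₗ[Γ(F.Q, U)] Γ(F.R, F.toBase ⁻¹ᵁ U) :=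
    (MvPolynomial.aeval ξ).toLinearMap ∘ₗ Submodule.subtype _
  let Ψ : MvPolynomial.homogeneousSubmodule ι Γ(F.Q, U) 1 →ₗ[Γ(F.Q, U)] Γ(T, V) :=
    (MvPolynomial.aeval w).toLinearMap ∘ₗ Submodule.subtype _
  -- The defining property of the linear span: forms that vanish on the family vanish on `T`.
  have hΦΨ (x) (hx : Φ x = 0) : Ψ x = 0 :=
    hT ⟨U, hU⟩ x.1 x.2 (vanishesOver_of_eval₂_eq_zero F hξ x.2 hx) j
  let N (a : κ₁) (b : κ₂) : MvPolynomial.homogeneousSubmodule ι Γ(F.Q, U) 1 :=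
    ⟨MvPolynomial.map (scalarsOn F.str U) (M a b), (hM a b).map _⟩
  let f₀ := MvPolynomial.eval₂Hom
    (scalarsOn (F.toAmbient ≫ PSpace.str k ι) (F.toBase ⁻¹ᵁ U)) ξ
  have hΦN (a : κ₁) (b : κ₂) : Φ (N a b) = f₀ (M a b) := by
    change MvPolynomial.eval₂ (F.toBase.app U).hom ξ (MvPolynomial.map _ _) =
      MvPolynomial.eval₂ _ _ _
    rw [MvPolynomial.eval₂_map, F.toAmbient_str, ← appLE_comp_scalarsOn F.toBase F.str U _ le_rfl,
      Scheme.Hom.appLE_eq_app]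
  let e (p : Fin n) : MvPolynomial.homogeneousSubmodule ι Γ(F.Q, U) 1 :=
    ⟨∑ l, MvPolynomial.C (scalarsOn F.str U (c p l)) * MvPolynomial.X l,
      MvPolynomial.IsHomogeneous.sum _ _ _ fun l _ ↦ by
        simpa using (MvPolynomial.isHomogeneous_C ι (scalarsOn F.str U (c p l))).mul
          (MvPolynomial.isHomogeneous_X _ l)⟩
  have he (p : Fin n) : Φ (e p) = ∑ l, scalarsOn F.str U (c p l) • ξ l := by
    simp only [Φ, e, LinearMap.comp_apply, Submodule.subtype_apply, AlgHom.toLinearMap_apply,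
      map_sum, map_mul, MvPolynomial.aeval_C, MvPolynomial.aeval_X, Algebra.smul_def]
  obtain ⟨e₁, e₂, rfl⟩ := hm
  have key := pow_mul_det_eq_zero Φ Ψ hΦΨ N _ _
    (fun a b ↦ (hΦN a b).trans (eval₂_entry_eq_mul f₀
      (fun m hm ↦ hξ.eval₂_eq_zero (isHomogeneous_of_mem_minors hM hm) (h2 m hm)) α β
      hξ.eval₂_self a b)) ht e h (by simpa only [he] using hh) e₁ e₂
  have hΨN : (Matrix.of fun p q ↦ Ψ (N (e₁ p) (e₂ q))).det =
      pullChart g (a ⁻¹ᵁ U) j (dehom j (M.submatrix e₁ e₂).det) := by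
    rw [RingHom.map_det, RingHom.map_det]
    congr 1
    ext p q
    change MvPolynomial.eval₂ (a.appLE U V inf_le_left).hom w (MvPolynomial.map _ _) =
      pullChart g (a ⁻¹ᵁ U) j (dehom j (M (e₁ p) (e₂ q)))
    rw [MvPolynomial.eval₂_map, pullChart_dehom, appLE_comp_scalarsOn, hag]
    congr 1
    rw [resChart, scalarsOn, scalarsOn, ← RingHom.comp_assoc, ← CommRingCat.hom_comp,
      ← Functor.map_comp]
    rfl
  rw [hΨN] at key
  -- Since `h` has value `1` at `s`, its nonvanishing locus is a neighbourhood of `s` and contains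
  -- `a y`; there the power of `h` can be cancelled.
  have hyh : a y ∈ F.Q.basicOpen h := by
    refine hgen _ ?_
    have h3 := Scheme.basicOpen_appLE s ⊤ U hsU h
    have h4 : (s.appLE U ⊤ hsU) h = 1 := hh1
    rw [h4, Scheme.basicOpen_of_isUnit _ isUnit_one] at h3
    exact (h3.le (show pt ∈ ⊤ from trivial)).2
  have hle : V ⊓ a ⁻¹ᵁ F.Q.basicOpen h ≤ g ⁻¹ᵁ chart j := inf_le_left.trans inf_le_right
  refine ⟨V ⊓ a ⁻¹ᵁ F.Q.basicOpen h, hle, ⟨⟨hgen U hptU, hy⟩, hyh⟩, ?_⟩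
  let ρ := (T.presheaf.map (homOfLE (inf_le_left : V ⊓ a ⁻¹ᵁ F.Q.basicOpen h ≤ V)).op).hom
  have hu : IsUnit (ρ (algebraMap Γ(F.Q, U) Γ(T, V) h)) := by
    change IsUnit ((T.presheaf.map _).hom ((a.appLE U V inf_le_left).hom h))
    rw [← RingHom.comp_apply, ← CommRingCat.hom_comp, Scheme.Hom.appLE_map,
      ← Scheme.Hom.map_appLE a (inf_le_right : V ⊓ a ⁻¹ᵁ F.Q.basicOpen h ≤ _)
        (homOfLE (Scheme.basicOpen_le _ h)).op, CommRingCat.hom_comp, RingHom.comp_apply]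
    exact (RingedSpace.isUnit_res_basicOpen _ _).map _
  have h5 := congrArg ρ key
  rw [map_zero, map_mul, map_pow, map_pow] at h5
  have h6 := (((hu.pow 2).pow t).mul_right_eq_zero).mp h5
  have h7 : g.app (chart j) ≫ T.presheaf.map (homOfLE hle).op =
      g.appLE (chart j) V inf_le_right ≫ T.presheaf.map (homOfLE inf_le_left).op := by
    rw [Scheme.Hom.appLE_map, Scheme.Hom.app_eq_appLE, Scheme.Hom.appLE_map]
  exact (congrArg (fun φ ↦ φ.hom (dehom j (M.submatrix e₁ e₂).det)) h7).trans h6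

lemma rankLE_le_relativeLinearSpan {κ₁ κ₂ : Type} [Fintype κ₁] [Fintype κ₂] [Infinite k]
    {M : Matrix κ₁ κ₂ (MvPolynomial ι k)} (hM : ∀ a b, (M a b).IsHomogeneous 1)
    {X : Scheme.{u}} (f : X ⟶ rankEq M 1) (F : FiniteFamily (f ≫ rankEqι M 1)) {n r : ℕ}
    (hn : n ≤ r) (hdeg : F.HasDegree n) (hind : F.Independent) :
    rankLE M r ≤ F.relativeLinearSpan := by
  have hF : F.toAmbient = (F.incl ≫ pullback.snd _ _ ≫ f) ≫ rankEqι M 1 := by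
    simp only [FiniteFamily.toAmbient, Category.assoc]
  -- The adjunction between inverse and direct image of ideal sheaves reduces the claim to each `J`
  -- in the infimum defining the span, so the forms need not be shown to vanish on the span itself.
  refine Scheme.IdealSheafData.le_map_iff_comap_le.mpr (le_sInf fun J hJ ↦ ?_)
  refine Scheme.IdealSheafData.le_map_iff_comap_le.mp (zeroIdeal_le_ker _ _ fun m hm ↦ ?_)
  refine vanishes_minor hM F hdeg hind (fun m hm ↦ ?_) (fun y ↦ ?_)
    (J.subschemeι ≫ pullback.fst _ _) _ ?_ (fun U f hf h ↦ hJ U 1 f le_rfl hf h)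
    (Nat.lt_succ_of_le hn) hm
  · rw [hF]
    exact (vanishes_rankEqι hM 1 m hm).comp _
  · rw [hF]
    let z := (F.incl ≫ pullback.snd _ _ ≫ f) y
    obtain ⟨_, ⟨e₁, e₂, rfl⟩, j, hj⟩ :=
      exists_mem_basicOpen (S := minors M 1) (y := rankEqι M 1 z) z.2
    rw [Matrix.det_fin_one] at hj
    exact ⟨j, e₁ 0, e₂ 0, hj⟩
  · rw [Category.assoc, Category.assoc, pullback.condition]

end LinearSpan

end CactusScheme
end
theorem theorem3 {k : Type u} [Field k] [IsAlgClosed k] {ι κ₁ κ₂ : Type}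
    [Fintype ι] [Fintype κ₁] [Fintype κ₂]
    (M : Matrix κ₁ κ₂ (MvPolynomial ι k)) (hM : ∀ a b, (M a b).IsHomogeneous 1)
    (hM0 : ∀ w : ι → k, (∀ a b, MvPolynomial.eval w (M a b) = 0) → w = 0)
    (r : ℕ) {X : Scheme.{u}} (h : X ⟶ CactusScheme.rankEq M 1) [IsImmersion h]
    (hemb : IsImmersion (h ≫ CactusScheme.proj₁ M hM))
    (hind : CactusScheme.ImposesIndependentConditions (h ≫ CactusScheme.proj₁ M hM) r) :
    ∃ g : (CactusScheme.cactus r (h ≫ CactusScheme.rankEqι M 1)).subscheme ⟶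
        (CactusScheme.rankLE M r).subscheme,
      g ≫ (CactusScheme.rankLE M r).subschemeι =
        (CactusScheme.cactus r (h ≫ CactusScheme.rankEqι M 1)).subschemeι := by
  -- Needed for the general bilinear form that avoids finitely many points.
  have : Infinite k := IsAlgClosed.instInfinite
  have hle : CactusScheme.rankLE M r ≤ CactusScheme.cactus r (h ≫ CactusScheme.rankEqι M 1) := by
    refine le_sInf ?_
    rintro _ ⟨n, F, hn, hdeg, hF, rfl⟩
    exact CactusScheme.rankLE_le_relativeLinearSpan hM h F hn hdeg hF
  exact ⟨Scheme.IdealSheafData.inclusion hle, Scheme.IdealSheafData.inclusion_subschemeι _⟩
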